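/- Let $R$ be a commutative Gorenstein ring, that is, a commutative noetherian ring of finite injective dimension as a module over itself, and let $G$ be any group, with group ring $RG$. All modules are left modules. Let $\mathrm{silf}\,RG$ be the supremum of the injective dimensions of flat $RG$-modules, $\mathrm{sfli}\,RG$ the supremum of the flat dimensions of injective $RG$-modules, and $\mathrm{splf}\,RG$ the supremum of the projective dimensions of flat $RG$-modules. Let $\overline{\mathcal P}(RG)$ and $\overline{\mathcal F}(RG)$ be the classes of $RG$-modules of finite projective dimension and of finite flat dimension, respectively. Then the following are equivalent: 1. $\mathrm{silf}\,RG<\infty$. 2. $\mathrm{sfli}\,RG<\infty$ and $\mathrm{splf}\,RG<\infty$. 3. $\mathrm{sfli}\,RG<\infty$ and $\overline{\mathcal P}(RG)=\overline{\mathcal F}(RG)$. -/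

import Mathlib

open CategoryTheory
open scoped TensorProduct

universe u v w

noncomputable section

namespace GroupRingDim

section Flat

variable (Λ : Type u) [Ring Λ]

/-- The subgroup of `A ⊗[ℤ] M` generated by the elements `(a · r) ⊗ m - a ⊗ (r • m)`, for a right
`Λ`-module `A` (that is, a module over `Λᵐᵒᵖ`) and a left `Λ`-module `M`. -/
def balancedRel (A : Type v) [AddCommGroup A] [Module Λᵐᵒᵖ A]
    (M : Type w) [AddCommGroup M] [Module Λ M] : AddSubgroup (A ⊗[ℤ] M) :=
  AddSubgroup.closure
    {t | ∃ (a : A) (r : Λ) (m : M), t = (MulOpposite.op r • a) ⊗ₜ[ℤ] m - a ⊗ₜ[ℤ] (r • m)}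

/-- The tensor product `A ⊗_Λ M` over a not necessarily commutative ring `Λ` of a right module `A`
and a left module `M`, an abelian group. -/
abbrev BalancedTensor (A : Type v) [AddCommGroup A] [Module Λᵐᵒᵖ A]
    (M : Type w) [AddCommGroup M] [Module Λ M] : Type (max v w) :=
  (A ⊗[ℤ] M) ⧸ balancedRel Λ A M

theorem balancedRel_le_comap {A B : Type v} [AddCommGroup A] [Module Λᵐᵒᵖ A]
    [AddCommGroup B] [Module Λᵐᵒᵖ B] (f : A →ₗ[Λᵐᵒᵖ] B)
    (M : Type w) [AddCommGroup M] [Module Λ M] :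
    balancedRel Λ A M ≤
      (balancedRel Λ B M).comap (f.toAddMonoidHom.toIntLinearMap.rTensor M).toAddMonoidHom := by
  refine (AddSubgroup.closure_le _).2 ?_
  rintro _ ⟨a, r, m, rfl⟩
  refine AddSubgroup.subset_closure ⟨f a, r, m, ?_⟩
  simp

/-- The homomorphism `f ⊗ 1 : A ⊗_Λ M → B ⊗_Λ M` induced by a homomorphism `f : A → B` of right
`Λ`-modules. -/
def BalancedTensor.map {A B : Type v} [AddCommGroup A] [Module Λᵐᵒᵖ A]
    [AddCommGroup B] [Module Λᵐᵒᵖ B] (f : A →ₗ[Λᵐᵒᵖ] B)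
    (M : Type w) [AddCommGroup M] [Module Λ M] :
    BalancedTensor Λ A M →+ BalancedTensor Λ B M :=
  QuotientAddGroup.map _ _ (f.toAddMonoidHom.toIntLinearMap.rTensor M).toAddMonoidHom
    (balancedRel_le_comap Λ f M)

/-- A left module `M` over an arbitrary ring `Λ` is flat if `- ⊗_Λ M` preserves injections of right
`Λ`-modules. (Mathlib's `Module.Flat` is only available over commutative rings.) -/
def IsFlat (M : Type w) [AddCommGroup M] [Module Λ M] : Prop :=
  ∀ (A B : Type u) [AddCommGroup A] [Module Λᵐᵒᵖ A] [AddCommGroup B] [Module Λᵐᵒᵖ B]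
    (f : A →ₗ[Λᵐᵒᵖ] B), Function.Injective f →
      Function.Injective (BalancedTensor.map Λ f M)

end Flat

section Dimensions

variable {Λ : Type u} [Ring Λ]

/-- `M` has a flat resolution `0 → F_n → ⋯ → F_1 → F_0 → M → 0` of length `n`. -/
def HasFlatDimensionLE (M : ModuleCat.{u} Λ) (n : ℕ) : Prop :=
  ∃ (F : ℕ → ModuleCat.{u} Λ) (d : ∀ i, F (i + 1) →ₗ[Λ] F i) (ε : F 0 →ₗ[Λ] M),
    (∀ i, IsFlat Λ (F i)) ∧ (∀ i, n < i → Subsingleton (F i)) ∧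
    Function.Surjective ε ∧ Function.Exact (d 0) ε ∧
    ∀ i, Function.Exact (d (i + 1)) (d i)

/-- The flat dimension of a left module, the least length of a flat resolution (`⊤` if there is no
finite one). -/
def flatDimension (M : ModuleCat.{u} Λ) : ℕ∞ :=
  ⨅ (n : ℕ) (_ : HasFlatDimensionLE M n), (n : ℕ∞)

variable (Λ)

/-- The supremum of the injective dimensions of flat left `Λ`-modules. -/
def silf : WithBot ℕ∞ :=
  ⨆ (M : ModuleCat.{u} Λ) (_ : IsFlat Λ M), injectiveDimension M

/-- The supremum of the flat dimensions of injective left `Λ`-modules. -/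
def sfli : ℕ∞ :=
  ⨆ (M : ModuleCat.{u} Λ) (_ : Injective M), flatDimension M

/-- The supremum of the projective dimensions of flat left `Λ`-modules. -/
def splf : WithBot ℕ∞ :=
  ⨆ (M : ModuleCat.{u} Λ) (_ : IsFlat Λ M), projectiveDimension M

/-- The class of left `Λ`-modules of finite projective dimension. -/
def finiteProjectiveDimension : Set (ModuleCat.{u} Λ) :=
  {M | projectiveDimension M < ⊤}

/-- The class of left `Λ`-modules of finite flat dimension. -/
def finiteFlatDimension : Set (ModuleCat.{u} Λ) :=
  {M | flatDimension M < ⊤}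

end Dimensions

/-- A commutative Gorenstein ring: a noetherian commutative ring of finite injective dimension as a
module over itself. -/
class IsGorensteinRing (R : Type u) [CommRing R] : Prop where
  isNoetherianRing : IsNoetherianRing R
  injectiveDimension_lt_top : injectiveDimension (ModuleCat.of R R) < ⊤

end GroupRingDim

end

/-! Write Λ for the group ring RG, and `M⁺ = Hom(M, ℚ/ℤ)` for the character module, which is
injective exactly when `M` is flat.

If flat modules have injective dimension at most `n`, then splf is at most `n`: the syzygies of a
flat module are flat, so the `(n+1)`-st extension group between a flat module and any flat module
vanishes, and this splits the presentation of the `n`-th syzygy.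

The bound on sfli is the delicate half. Flatness over RG can be tested over the group rings of
countable subgroups `H`, and injective RG-modules stay injective over RH, so it suffices to bound
the injective dimension of `I⁺` for `I` injective over RH. As `R` is noetherian and `H` countable,
submodules of a free right RH-module of countable rank are countably generated. For such a ring Γ,
acting on the right, `exists_eq_sum_finsuppTmul` shows by a diagonal argument that vanishing of Ext
from a countably presented module into `Γ^ℕ / Γ^(ℕ)` forces vanishing of Ext into `I⁺`. The quotient
`Γ^ℕ / Γ^(ℕ)` has injective dimension at most `n` because the free module `Γ^(ℕ)` has, and cyclic
modules suffice by Baer's criterion.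

Conversely, let sfli and splf be finite. Then injective RG-modules have projective dimension at most
some `s`. A finite injective resolution of `R`, coinduced to `G`, gives the same bound for `C =
Hom_R(RG, R)`. For `F` free over RG and `E` injective over `R`, the module `F ⊗ E` is a retract of
`Hom_R(C, F ⊗ E)` with diagonal action, hence of injective dimension at most `s`. Resolving `R` by
such `E` bounds the injective dimension of free modules by `d + s`, where `d` is that of `R`. The
same bound passes to all modules of finite projective dimension, in particular to flat ones.

Finally, splf is finite exactly when finite flat and finite projective dimension agree: a direct sum
of flat modules of unbounded projective dimension would be a counterexample. -/

noncomputable section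

namespace GroupRingDim

open Abelian

/-! ### Short exact sequences, retracts and injectivity of modules -/

section ShortExact

variable {Λ : Type u} [Ring Λ] {A B C : Type u} [AddCommGroup A] [Module Λ A]
  [AddCommGroup B] [Module Λ B] [AddCommGroup C] [Module Λ C]

/-- The short exact sequence in `ModuleCat Λ` of an exact pair of linear maps. -/
theorem shortExact_ofHom {f : A →ₗ[Λ] B} {g : B →ₗ[Λ] C} (hf : Function.Injective f)
    (hg : Function.Surjective g) (h : Function.Exact f g) :
    (ShortComplex.mk (ModuleCat.ofHom f) (ModuleCat.ofHom g)
      (by rw [← ModuleCat.ofHom_comp, h.linearMap_comp_eq_zero]; rfl)).ShortExact :=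
  ModuleCat.shortComplex_shortExact _ h hf hg

/-- The short exact sequence of the kernel of a surjection. -/
theorem shortExact_ker {g : B →ₗ[Λ] C} (hg : Function.Surjective g) :
    (ShortComplex.mk (ModuleCat.ofHom (LinearMap.ker g).subtype) (ModuleCat.ofHom g)
      (by ext x; exact x.2)).ShortExact :=
  shortExact_ofHom (Submodule.subtype_injective _) hg (LinearMap.exact_subtype_ker_map g)

/-- The short exact sequence of the cokernel of an injection. -/
theorem shortExact_coker {f : A →ₗ[Λ] B} (hf : Function.Injective f) :
    (ShortComplex.mk (ModuleCat.ofHom f) (ModuleCat.ofHom (LinearMap.range f).mkQ)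
      (by ext x; simp)).ShortExact :=
  shortExact_ofHom hf (Submodule.mkQ_surjective _) (LinearMap.exact_map_mkQ_range f)

theorem hasInjectiveDimensionLT_one_iff :
    HasInjectiveDimensionLT (ModuleCat.of Λ A) 1 ↔ Module.Baer Λ A := by
  rw [← injective_iff_hasInjectiveDimensionLT_one, ← Module.injective_iff_injective_object,
    Module.Baer.iff_injective]

/-- A split surjection of modules, as a retract. -/
def retractOfComp {i : A →ₗ[Λ] B} {r : B →ₗ[Λ] A} (h : r ∘ₗ i = LinearMap.id) :
    Retract (ModuleCat.of Λ A) (ModuleCat.of Λ B) where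
  i := ModuleCat.ofHom i
  r := ModuleCat.ofHom r
  retract := by rw [← ModuleCat.ofHom_comp, h]; rfl

theorem baer_of_retract {Λ A B : Type*} [Ring Λ] [AddCommGroup A] [Module Λ A] [AddCommGroup B]
    [Module Λ B] {i : A →ₗ[Λ] B} {r : B →ₗ[Λ] A} (h : r ∘ₗ i = LinearMap.id)
    (hB : Module.Baer Λ B) : Module.Baer Λ A := fun J g ↦
  have ⟨g', hg'⟩ := hB J (i ∘ₗ g)
  ⟨r ∘ₗ g', fun x hx ↦ by simpa [hg' x hx] using DFunLike.congr_fun h (g ⟨x, hx⟩)⟩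

theorem exists_injective_embedding (Y : Type u) [AddCommGroup Y] [Module Λ Y] :
    ∃ (E : ModuleCat.{u} Λ) (f : Y →ₗ[Λ] E), Injective E ∧ Function.Injective f := by
  obtain ⟨E, _, f, _⟩ := EnoughInjectives.presentation (ModuleCat.of Λ Y)
  exact ⟨E, f.hom, ‹_›, (ModuleCat.mono_iff_injective f).mp ‹_›⟩

end ShortExact

/-! ### Dimension shifting and Baer's criterion for injective dimension -/

section Ext

variable {Λ : Type u} [Ring Λ]

/-- Dimension shifting in the first variable. -/
theorem subsingleton_ext_X₁_iff {S : ShortComplex (ModuleCat.{u} Λ)} (hS : S.ShortExact)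
    [Projective S.X₂] (Y : ModuleCat.{u} Λ) (n : ℕ) :
    Subsingleton (Ext S.X₁ Y (n + 1)) ↔ Subsingleton (Ext S.X₃ Y (n + 2)) := by
  constructor
  · intro h
    refine subsingleton_of_forall_eq 0 fun x ↦ ?_
    obtain ⟨y, rfl⟩ := Ext.contravariant_sequence_exact₃ hS Y x
      (Ext.eq_zero_of_projective _) (show 1 + (n + 1) = n + 2 by ring)
    rw [h.elim y 0, Ext.comp_zero]
  · intro h
    refine subsingleton_of_forall_eq 0 fun x ↦ ?_
    obtain ⟨y, rfl⟩ := Ext.contravariant_sequence_exact₁ hS Y x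
      (show 1 + (n + 1) = n + 2 by ring) (h.elim _ _)
    rw [Ext.eq_zero_of_projective y, Ext.comp_zero]

/-- Dimension shifting in the second variable. -/
theorem subsingleton_ext_succ_of_injective {S : ShortComplex (ModuleCat.{u} Λ)}
    (hS : S.ShortExact) [Injective S.X₂] (X : ModuleCat.{u} Λ) (n : ℕ)
    (h : Subsingleton (Ext X S.X₁ (n + 2))) : Subsingleton (Ext X S.X₃ (n + 1)) := by
  refine subsingleton_of_forall_eq 0 fun x ↦ ?_
  obtain ⟨y, rfl⟩ := Ext.covariant_sequence_exact₃ X hS x rfl (h.elim _ _)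
  rw [Ext.eq_zero_of_injective y, Ext.zero_comp]

/-- The first `Ext` group against a projective presentation consists of the homomorphisms on the
kernel modulo those that extend. -/
theorem subsingleton_ext_one_iff {S : ShortComplex (ModuleCat.{u} Λ)} (hS : S.ShortExact)
    [Projective S.X₂] (Y : ModuleCat.{u} Λ) :
    Subsingleton (Ext S.X₃ Y 1) ↔ ∀ f : S.X₁ ⟶ Y, ∃ g : S.X₂ ⟶ Y, S.f ≫ g = f := by
  constructor
  · intro h f
    obtain ⟨y, hy⟩ := Ext.contravariant_sequence_exact₁ hS Y (Ext.mk₀ f)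
      (show 1 + 0 = 1 from rfl) (h.elim _ _)
    obtain ⟨g, rfl⟩ := Ext.homEquiv₀.symm.surjective y
    refine ⟨g, ?_⟩
    simp only [Ext.homEquiv₀_symm_apply, Ext.mk₀_comp_mk₀] at hy
    exact Ext.homEquiv₀.symm.injective hy
  · intro h
    refine subsingleton_of_forall_eq 0 fun x ↦ ?_
    obtain ⟨y, rfl⟩ := Ext.contravariant_sequence_exact₃ hS Y x
      (Ext.eq_zero_of_projective _) (show 1 + 0 = 1 from rfl)
    obtain ⟨f, rfl⟩ := Ext.homEquiv₀.symm.surjective y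
    obtain ⟨g, rfl⟩ := h f
    simp only [Ext.homEquiv₀_symm_apply]
    rw [← Ext.mk₀_comp_mk₀, hS.extClass_comp_assoc]

/-- Baer's criterion for the injective dimension. -/
theorem hasInjectiveDimensionLE_of_cyclic (n : ℕ) (Y : ModuleCat.{u} Λ)
    (h : ∀ J : Ideal Λ, Subsingleton (Ext (ModuleCat.of Λ (Λ ⧸ J)) Y (n + 1))) :
    HasInjectiveDimensionLE Y n := by
  induction n generalizing Y with
  | zero =>
    refine hasInjectiveDimensionLT_one_iff.2 fun J f ↦ ?_
    have hS := shortExact_ofHom (f := J.subtype) (g := J.mkQ) (Submodule.subtype_injective _)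
      (Submodule.mkQ_surjective _) (LinearMap.exact_subtype_mkQ J)
    have : Projective (ModuleCat.of Λ Λ) := ModuleCat.projective_of_categoryTheory_projective _
    obtain ⟨g, hg⟩ := (subsingleton_ext_one_iff hS Y).1 (h J) (ModuleCat.ofHom f)
    exact ⟨g.hom, fun x hx ↦ congr(ModuleCat.Hom.hom $hg ⟨x, hx⟩)⟩
  | succ n ih =>
    -- The cokernel of an embedding into an injective module inherits the hypothesis one degree
    -- lower.
    obtain ⟨E, f, hE, hf⟩ := exists_injective_embedding (Λ := Λ) Y
    have hS := shortExact_coker hf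
    exact (hS.hasInjectiveDimensionLT_X₃_iff n hE).1
      (ih _ fun J ↦ subsingleton_ext_succ_of_injective hS _ n (h J))

end Ext

/-! ### Character modules and flatness -/

section Character

variable {Λ : Type u} [Ring Λ]

/-- The character module of a left module is a right module. -/
instance characterModuleOp (M : Type w) [AddCommGroup M] [Module Λ M] :
    Module Λᵐᵒᵖ (CharacterModule M) where
  smul a c := c.comp (DistribSMul.toAddMonoidHom M a.unop)
  one_smul c := by ext x; exact congrArg c (one_smul Λ x)
  mul_smul a b c := by ext x; exact congrArg c (mul_smul b.unop a.unop x)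
  smul_zero _ := rfl
  smul_add _ _ _ := rfl
  add_smul a b c := by
    ext x
    exact (congrArg c (add_smul a.unop b.unop x)).trans (c.map_add _ _)
  zero_smul c := by ext x; exact (congrArg c (zero_smul Λ x)).trans c.map_zero

theorem op_smul_character_apply {M : Type w} [AddCommGroup M] [Module Λ M] (a : Λᵐᵒᵖ)
    (c : CharacterModule M) (m : M) : (a • c) m = c (a.unop • m) := rfl

/-- The homomorphism of character modules induced by a homomorphism of left modules. -/
def characterMap {M N : Type*} [AddCommGroup M] [Module Λ M] [AddCommGroup N] [Module Λ N]
    (f : M →ₗ[Λ] N) : CharacterModule N →ₗ[Λᵐᵒᵖ] CharacterModule M where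
  toFun c := c.comp f.toAddMonoidHom
  map_add' _ _ := rfl
  map_smul' a c := by
    ext x
    exact congrArg c (f.map_smul a.unop x).symm

theorem exists_character_extension {A B : Type*} [AddCommGroup A] [AddCommGroup B] (f : A →+ B)
    (hf : Function.Injective f) (c : A →+ AddCircle (1 : ℚ)) :
    ∃ d : B →+ AddCircle (1 : ℚ), ∀ a, d (f a) = c a := by
  obtain ⟨d, hd⟩ :=
    (Module.Baer.of_divisible (AddCircle (1 : ℚ))).extension_property_addMonoidHom f hf c
  exact ⟨d, DFunLike.congr_fun hd⟩

section Exact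

variable {A B C : Type w} [AddCommGroup A] [Module Λ A] [AddCommGroup B] [Module Λ B]
  [AddCommGroup C] [Module Λ C]

theorem characterMap_injective {g : B →ₗ[Λ] C} (hg : Function.Surjective g) :
    Function.Injective (characterMap g) := by
  intro c d h
  ext x
  obtain ⟨y, rfl⟩ := hg x
  exact DFunLike.congr_fun h y

theorem characterMap_surjective {f : A →ₗ[Λ] B} (hf : Function.Injective f) :
    Function.Surjective (characterMap f) := by
  intro c
  obtain ⟨d, hd⟩ := exists_character_extension f.toAddMonoidHom hf c
  exact ⟨d, CharacterModule.ext _ hd⟩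

theorem characterMap_exact {f : A →ₗ[Λ] B} {g : B →ₗ[Λ] C} (hg : Function.Surjective g)
    (h : Function.Exact f g) : Function.Exact (characterMap g) (characterMap f) := by
  intro c
  constructor
  · intro hc
    have hle : g.toAddMonoidHom.ker ≤ AddMonoidHom.ker c := by
      intro x hx
      obtain ⟨y, rfl⟩ := (h x).1 hx
      exact DFunLike.congr_fun hc y
    refine ⟨AddMonoidHom.liftOfSurjective g.toAddMonoidHom hg ⟨c, hle⟩, ?_⟩
    ext x
    exact DFunLike.congr_fun (AddMonoidHom.liftOfRightInverse_comp _ _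
      (Function.rightInverse_surjInv hg) ⟨c, hle⟩) x
  · rintro ⟨d, rfl⟩
    ext x
    exact (congrArg d (h.apply_apply_eq_zero x)).trans d.map_zero

end Exact

section Flat

variable {M : Type u} [AddCommGroup M] [Module Λ M] {A : Type u} [AddCommGroup A]
  [Module Λᵐᵒᵖ A]

/-- A homomorphism of right modules into a character module, as a character of a balanced tensor
product. -/
def characterUncurry (f : A →ₗ[Λᵐᵒᵖ] CharacterModule M) :
    BalancedTensor Λ A M →+ AddCircle (1 : ℚ) :=
  QuotientAddGroup.lift _
    (TensorProduct.liftAddHom (f.toAddMonoidHom : A →+ (M →+ AddCircle (1 : ℚ)))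
      fun r a m ↦ by
        have h := DFunLike.congr_fun (map_zsmul f r a) m
        exact h.trans (map_zsmul (f a) r m).symm)
    ((AddSubgroup.closure_le _).2 <| by
      rintro _ ⟨a, r, m, rfl⟩
      have h := DFunLike.congr_fun (map_smul f (MulOpposite.op r) a) m
      simp only [SetLike.mem_coe, AddMonoidHom.mem_ker, map_sub, sub_eq_zero]
      exact h)

/-- A character of a balanced tensor product, as a homomorphism into a character module. -/
def characterCurry (c : BalancedTensor Λ A M →+ AddCircle (1 : ℚ)) :
    A →ₗ[Λᵐᵒᵖ] CharacterModule M where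
  toFun a := (c.comp (QuotientAddGroup.mk' _)).comp (TensorProduct.mk ℤ A M a).toAddMonoidHom
  map_add' a b := by
    ext m
    change c (QuotientAddGroup.mk ((a + b) ⊗ₜ[ℤ] m)) = c (QuotientAddGroup.mk (a ⊗ₜ[ℤ] m)) +
      c (QuotientAddGroup.mk (b ⊗ₜ[ℤ] m))
    rw [TensorProduct.add_tmul, ← map_add]
    rfl
  map_smul' r a := by
    ext m
    change c (QuotientAddGroup.mk ((r • a) ⊗ₜ[ℤ] m)) =
      c (QuotientAddGroup.mk (a ⊗ₜ[ℤ] (r.unop • m)))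
    congr 1
    refine (QuotientAddGroup.eq_iff_sub_mem).2 (AddSubgroup.subset_closure ⟨a, r.unop, m, rfl⟩)

theorem balancedTensor_hom_ext {c d : BalancedTensor Λ A M →+ AddCircle (1 : ℚ)}
    (h : ∀ a m, c (QuotientAddGroup.mk (a ⊗ₜ[ℤ] m)) = d (QuotientAddGroup.mk (a ⊗ₜ[ℤ] m))) :
    c = d := by
  refine QuotientAddGroup.addMonoidHom_ext _ ?_
  ext x
  induction x using TensorProduct.induction_on with
  | zero => simp
  | tmul a m => exact h a m
  | add x y hx hy => simp_all

/-- Lambek's criterion: a module is flat if and only if its character module is injective. -/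
theorem isFlat_iff_baer : IsFlat Λ M ↔ Module.Baer Λᵐᵒᵖ (CharacterModule M) := by
  constructor
  · intro h
    rw [Module.Baer.iff_injective]
    refine ⟨fun A B _ _ _ _ f hf g ↦ ?_⟩
    obtain ⟨d, hd⟩ := exists_character_extension _ (h A B f hf) (characterUncurry g)
    refine ⟨characterCurry d, fun x ↦ ?_⟩
    ext m
    exact hd (QuotientAddGroup.mk (x ⊗ₜ[ℤ] m))
  · intro h A B _ _ _ _ f hf
    rw [injective_iff_map_eq_zero]
    intro t ht
    by_contra hne
    obtain ⟨c, hc⟩ := CharacterModule.exists_character_apply_ne_zero_of_ne_zero hne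
    obtain ⟨g, hg⟩ := h.extension_property f hf (characterCurry c)
    have : (characterUncurry g).comp (BalancedTensor.map Λ f M) = c := by
      refine balancedTensor_hom_ext fun a m ↦ ?_
      exact DFunLike.congr_fun (DFunLike.congr_fun hg a) m
    apply hc
    refine (DFunLike.congr_fun this t).symm.trans ?_
    rw [AddMonoidHom.comp_apply, ht, map_zero]

theorem IsFlat.of_retract {N : Type u} [AddCommGroup N] [Module Λ N] {i : M →ₗ[Λ] N}
    {r : N →ₗ[Λ] M} (h : r ∘ₗ i = LinearMap.id) (hN : IsFlat Λ N) : IsFlat Λ M := by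
  rw [isFlat_iff_baer] at *
  refine baer_of_retract (i := characterMap r) (r := characterMap i) ?_ hN
  ext c m
  exact congrArg c (DFunLike.congr_fun h m)

theorem IsFlat.of_equiv {N : Type u} [AddCommGroup N] [Module Λ N] (e : M ≃ₗ[Λ] N)
    (hN : IsFlat Λ N) : IsFlat Λ M :=
  .of_retract (i := e.toLinearMap) (r := e.symm.toLinearMap) (by ext; simp) hN

/-- The characters of a direct sum form the product of the character modules, so Baer's criterion
can be solved in each coordinate; the values `d i 1` assemble to the required character. -/
theorem isFlat_directSum {ι : Type u} {N : ι → Type u} [∀ i, AddCommGroup (N i)]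
    [∀ i, Module Λ (N i)] (h : ∀ i, IsFlat Λ (N i)) : IsFlat Λ (DirectSum ι N) := by
  classical
  rw [isFlat_iff_baer]
  intro J g
  choose d hd using fun i ↦
    isFlat_iff_baer.1 (h i) J (characterMap (DirectSum.lof Λ ι N i) ∘ₗ g)
  refine ⟨LinearMap.toSpanSingleton Λᵐᵒᵖ (CharacterModule (DirectSum ι N))
    (DirectSum.toAddMonoid fun i ↦ (d i 1 : N i →+ AddCircle (1 : ℚ))), fun x hx ↦ ?_⟩
  refine DirectSum.addHom_ext fun i m ↦ ?_
  have h₁ := DFunLike.congr_fun (hd i x hx) m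
  have h₂ := DFunLike.congr_fun ((d i).map_smul x 1) m
  rw [smul_eq_mul, mul_one, op_smul_character_apply] at h₂
  refine Eq.trans ?_ h₁
  rw [h₂]
  have h₃ : x.unop • DirectSum.of N i m = DirectSum.of N i (x.unop • m) :=
    ((DirectSum.lof Λ ι N i).map_smul x.unop m).symm
  exact (congrArg (DirectSum.toAddMonoid fun i ↦ (d i 1 : N i →+ AddCircle (1 : ℚ))) h₃).trans
    (DirectSum.toAddMonoid_of _ i _)

/-- The character module of the ring is coinduced from `ℚ/ℤ`: a homomorphism into it is determined
by its composite with evaluation at 1, and this composite extends because `ℚ/ℤ` is divisible. -/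
theorem isFlat_self : IsFlat Λ Λ := by
  rw [isFlat_iff_baer]
  intro J g
  let e : CharacterModule Λ →+ AddCircle (1 : ℚ) := AddMonoidHom.eval (1 : Λ)
  obtain ⟨d, hd⟩ := exists_character_extension J.subtype.toAddMonoidHom
    (Submodule.subtype_injective J) (e.comp g.toAddMonoidHom)
  refine ⟨LinearMap.toSpanSingleton Λᵐᵒᵖ (CharacterModule Λ)
    (d.comp (MulOpposite.opAddEquiv : Λ ≃+ Λᵐᵒᵖ).toAddMonoidHom), fun x hx ↦ ?_⟩
  ext l
  have h₁ : d (MulOpposite.op l * x) = g (MulOpposite.op l • ⟨x, hx⟩) 1 :=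
    hd (MulOpposite.op l • ⟨x, hx⟩)
  rw [map_smul, op_smul_character_apply, MulOpposite.unop_op, smul_eq_mul, mul_one] at h₁
  exact h₁

theorem isFlat_finsupp (ι : Type u) : IsFlat Λ (ι →₀ Λ) := by
  classical
  exact .of_equiv (finsuppLEquivDirectSum Λ Λ ι) (isFlat_directSum fun _ ↦ isFlat_self)

theorem isFlat_of_projective [Module.Projective Λ M] : IsFlat Λ M := by
  obtain ⟨s, hs⟩ := Module.projective_def'.1 ‹Module.Projective Λ M›
  exact .of_retract hs (isFlat_finsupp M)

/-- The kernel of a surjection between flat modules is flat. -/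
theorem IsFlat.ker {N : Type u} [AddCommGroup N] [Module Λ N] (hM : IsFlat Λ M)
    (hN : IsFlat Λ N) {f : M →ₗ[Λ] N} (hf : Function.Surjective f) :
    IsFlat Λ (LinearMap.ker f) := by
  rw [isFlat_iff_baer, ← hasInjectiveDimensionLT_one_iff] at *
  -- Dually, the characters of the kernel are a quotient of an injective module by an injective
  -- submodule.
  exact (shortExact_ofHom (characterMap_injective hf)
    (characterMap_surjective (Submodule.subtype_injective _))
    (characterMap_exact hf (LinearMap.exact_subtype_ker_map f))).hasInjectiveDimensionLT_X₃ 1 hM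
      inferInstance

end Flat

end Character

/-! ### Flat resolutions and comparison with projective dimension -/

section FlatDimension

variable {Λ : Type u} [Ring Λ]

theorem hasFlatDimensionLE_zero {M : ModuleCat.{u} Λ} (h : IsFlat Λ M) :
    HasFlatDimensionLE M 0 := by
  refine ⟨fun | 0 => M | _ + 1 => ModuleCat.of Λ PUnit, fun | 0 => 0 | _ + 1 => 0,
    LinearMap.id, ?_, ?_, Function.surjective_id, ?_, ?_⟩
  · rintro (_ | i)
    · exact h
    · exact isFlat_of_projective (Λ := Λ) (M := PUnit)
  · rintro (_ | i) hi
    · exact absurd hi (lt_irrefl _)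
    · exact inferInstanceAs (Subsingleton PUnit)
  · intro x
    exact ⟨fun hx ↦ ⟨0, hx.symm⟩, fun ⟨_, hy⟩ ↦ hy.symm⟩
  · rintro (_ | i) x
    · exact ⟨fun _ ↦ ⟨0, rfl⟩, fun _ ↦ rfl⟩
    · exact ⟨fun _ ↦ ⟨0, rfl⟩, fun _ ↦ rfl⟩

/-- Extending a flat resolution of a kernel. -/
theorem HasFlatDimensionLE.of_ker {F M : Type u} [AddCommGroup F] [Module Λ F] [AddCommGroup M]
    [Module Λ M] (hF : IsFlat Λ F) {f : F →ₗ[Λ] M} (hf : Function.Surjective f) {n : ℕ}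
    (h : HasFlatDimensionLE (ModuleCat.of Λ (LinearMap.ker f)) n) :
    HasFlatDimensionLE (ModuleCat.of Λ M) (n + 1) := by
  obtain ⟨E, d, ε, hE, h0, hε, hd0, hd⟩ := h
  refine ⟨fun | 0 => ModuleCat.of Λ F | i + 1 => E i,
    fun | 0 => (LinearMap.ker f).subtype ∘ₗ ε | i + 1 => d i, f, ?_, ?_, hf, ?_, ?_⟩
  · rintro (_ | i)
    · exact hF
    · exact hE i
  · rintro (_ | i) hi
    · exact absurd hi (Nat.not_lt_zero _)
    · exact h0 i (by lia)
  · intro x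
    constructor
    · intro hx
      obtain ⟨y, hy⟩ := hε ⟨x, hx⟩
      exact ⟨y, congrArg Subtype.val hy⟩
    · rintro ⟨y, rfl⟩
      exact (ε y).2
  · rintro (_ | i)
    · intro x
      refine Iff.trans ?_ (hd0 x)
      exact Submodule.coe_eq_zero
    · exact hd i

/-- A module of flat dimension zero is flat, and a module of flat dimension at most `n + 1` is a
quotient of a flat module by a submodule of flat dimension at most `n`. -/
theorem HasFlatDimensionLE.isFlat {M : ModuleCat.{u} Λ} (h : HasFlatDimensionLE M 0) :
    IsFlat Λ M := by
  obtain ⟨E, d, ε, hE, h0, hε, hd0, hd⟩ := h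
  have : Subsingleton (E 1) := h0 1 one_pos
  have hinj : Function.Injective ε := by
    rw [injective_iff_map_eq_zero]
    intro x hx
    obtain ⟨y, rfl⟩ := (hd0 x).1 hx
    rw [Subsingleton.elim y 0, map_zero]
  exact .of_equiv (LinearEquiv.ofBijective ε ⟨hinj, hε⟩).symm (hE 0)

theorem HasFlatDimensionLE.exists_ker {M : ModuleCat.{u} Λ} {n : ℕ}
    (h : HasFlatDimensionLE M (n + 1)) :
    ∃ (F : ModuleCat.{u} Λ) (f : F →ₗ[Λ] M), IsFlat Λ F ∧ Function.Surjective f ∧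
      HasFlatDimensionLE (ModuleCat.of Λ (LinearMap.ker f)) n := by
  obtain ⟨E, d, ε, hE, h0, hε, hd0, hd⟩ := h
  refine ⟨E 0, ε, hE 0, hε, fun i ↦ E (i + 1), fun i ↦ d (i + 1),
    (d 0).codRestrict _ fun x ↦ hd0.apply_apply_eq_zero x, fun i ↦ hE _,
    fun i hi ↦ h0 _ (by lia), ?_, ?_, fun i ↦ hd _⟩
  · rintro ⟨x, hx⟩
    obtain ⟨y, rfl⟩ := (hd0 x).1 hx
    exact ⟨y, rfl⟩
  · intro x
    rw [← hd 0 x]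
    exact (Submodule.coe_eq_zero (p := LinearMap.ker ε)).symm

/-- The canonical free cover of a module. -/
abbrev freeCover (M : Type u) [AddCommGroup M] [Module Λ M] : (M →₀ Λ) →ₗ[Λ] M :=
  Finsupp.linearCombination Λ id

theorem freeCover_surjective (M : Type u) [AddCommGroup M] [Module Λ M] :
    Function.Surjective (freeCover (Λ := Λ) M) :=
  Finsupp.linearCombination_surjective Λ Function.surjective_id

theorem projective_free (ι : Type u) : Projective (ModuleCat.of Λ (ι →₀ Λ)) :=
  ModuleCat.projective_of_categoryTheory_projective (ModuleCat.of Λ (ι →₀ Λ))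

theorem hasFlatDimensionLE_of_hasProjectiveDimensionLE {n : ℕ} {M : ModuleCat.{u} Λ}
    (h : HasProjectiveDimensionLE M n) : HasFlatDimensionLE M n := by
  induction n generalizing M with
  | zero =>
    have : Projective M := (projective_iff_hasProjectiveDimensionLE_zero M).2 h
    have : Module.Projective Λ M := ModuleCat.projective_of_module_projective M
    exact hasFlatDimensionLE_zero isFlat_of_projective
  | succ n ih =>
    refine .of_ker (isFlat_finsupp M) (freeCover_surjective M) (ih ?_)
    exact ((shortExact_ker (freeCover_surjective (Λ := Λ) M)).hasProjectiveDimensionLT_X₃_iff n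
      (projective_free M)).1 h

/-- If all flat modules have projective dimension at most `k`, then a module of flat dimension
at most `n` has projective dimension at most `n + k`. -/
theorem HasFlatDimensionLE.hasProjectiveDimensionLE {k : ℕ}
    (hk : ∀ M : ModuleCat.{u} Λ, IsFlat Λ M → HasProjectiveDimensionLE M k) {n : ℕ}
    {M : ModuleCat.{u} Λ} (h : HasFlatDimensionLE M n) : HasProjectiveDimensionLE M (n + k) := by
  induction n generalizing M with
  | zero => simpa using hk M h.isFlat
  | succ n ih =>
    obtain ⟨F, f, hF, hf, hK⟩ := h.exists_ker
    have h₁ := ih hK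
    have := hk F hF
    have h₂ : HasProjectiveDimensionLT F (n + k + 1 + 1) :=
      hasProjectiveDimensionLT_of_ge F (k + 1) _ (by lia)
    have := (shortExact_ker hf).hasProjectiveDimensionLT_X₃ (n + k + 1) h₁ h₂
    rwa [show n + 1 + k = n + k + 1 by ring]

end FlatDimension

/-! ### Projective dimension of flat modules -/

section FlatExt

variable {Λ : Type u} [Ring Λ]

/-- A flat module `M` with `Ext^{n+1}(M, N) = 0` for all flat `N` has projective dimension at most
`n`. -/
theorem hasProjectiveDimensionLE_of_subsingleton_ext_flat {n : ℕ} {M : ModuleCat.{u} Λ}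
    (hM : IsFlat Λ M)
    (h : ∀ N : ModuleCat.{u} Λ, IsFlat Λ N → Subsingleton (Ext M N (n + 1))) :
    HasProjectiveDimensionLE M n := by
  have hS := shortExact_ker (freeCover_surjective (Λ := Λ) M)
  have hP := projective_free (Λ := Λ) M
  have hK : IsFlat Λ (LinearMap.ker (freeCover (Λ := Λ) M)) :=
    (isFlat_finsupp M).ker hM (freeCover_surjective M)
  induction n generalizing M with
  | zero =>
    -- The kernel of the free cover is itself flat, so its identity extends to the free module and
    -- the presentation splits.
    obtain ⟨g, hg⟩ := (subsingleton_ext_one_iff hS _).1 (h (ModuleCat.of Λ _) hK) (𝟙 _)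
    have σ := ShortComplex.Splitting.ofExactOfRetraction _ hS.exact g hg hS.epi_g
    have hr : Retract M (ModuleCat.of Λ (M →₀ Λ)) := ⟨σ.s, _, σ.s_g⟩
    exact hr.hasProjectiveDimensionLT 1
  | succ n ih =>
    exact (hS.hasProjectiveDimensionLT_X₃_iff n hP).2 (ih (M := ModuleCat.of Λ _) hK
      (fun N hN ↦ (subsingleton_ext_X₁_iff hS N n).2 (h N hN))
      (shortExact_ker (freeCover_surjective _)) (projective_free _)
      ((isFlat_finsupp _).ker hK (freeCover_surjective _)))

/-- If all flat modules have injective dimension at most `n`, then they have projective dimension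
at most `n`. -/
theorem hasProjectiveDimensionLE_of_hasInjectiveDimensionLE_flat {n : ℕ}
    (h : ∀ N : ModuleCat.{u} Λ, IsFlat Λ N → HasInjectiveDimensionLE N n) (M : ModuleCat.{u} Λ)
    (hM : IsFlat Λ M) : HasProjectiveDimensionLE M n :=
  hasProjectiveDimensionLE_of_subsingleton_ext_flat hM fun N hN ↦
    have := h N hN
    HasInjectiveDimensionLT.subsingleton N (n + 1) (n + 1) le_rfl M

end FlatExt

/-! ### Countably presented modules and the diagonal argument -/

section CountablyPresented

variable {Λ : Type u} [Ring Λ] {I : Type v} [AddCommGroup I] [Module Λ I] {ι κ : Type w}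

/-- The homomorphism `y ↦ v ⊗ y` from `I` to the tensor product of a free right module with `I`. -/
def finsuppTmul (v : κ →₀ Λᵐᵒᵖ) : I →+ (κ →₀ I) where
  toFun y := v.mapRange (fun c ↦ c.unop • y) (zero_smul _ _)
  map_zero' := by ext; simp
  map_add' y z := by ext; simp

theorem liftAddHom_finsuppTmul {B : Type*} [AddCommGroup B] (c : κ → I →+ B) (v : κ →₀ Λᵐᵒᵖ)
    (y : I) :
    Finsupp.liftAddHom c (finsuppTmul v y) = v.sum fun k a ↦ c k (a.unop • y) := by
  simp only [finsuppTmul, AddMonoidHom.coe_mk, ZeroHom.coe_mk, Finsupp.liftAddHom_apply]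
  exact Finsupp.sum_mapRange_index fun k ↦ map_zero _

theorem liftAddHom_character_finsuppTmul (c : κ → CharacterModule I) (v : κ →₀ Λᵐᵒᵖ) (y : I) :
    Finsupp.liftAddHom (fun k ↦ (c k : I →+ AddCircle (1 : ℚ))) (finsuppTmul v y) =
      Finsupp.linearCombination Λᵐᵒᵖ c v y := by
  refine (liftAddHom_finsuppTmul _ v y).trans ?_
  rw [Finsupp.linearCombination_apply]
  induction v using Finsupp.induction_linear with
  | zero => rfl
  | add v w hv hw =>
    rw [Finsupp.sum_add_index', Finsupp.sum_add_index', hv, hw]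
    · rfl
    · simp
    · intros; exact add_smul _ _ _
    · intro k; simpa using (c k).map_zero
    · intro k a b; simpa [add_smul] using (c k).map_add _ _
  | single k a =>
    rw [Finsupp.sum_single_index (by simpa using (c k).map_zero),
      Finsupp.sum_single_index (by simp)]
    rfl

theorem liftAddHom_smul_finsuppTmul (ψ : (κ →₀ Λᵐᵒᵖ) →ₗ[Λᵐᵒᵖ] Λᵐᵒᵖ) (v : κ →₀ Λᵐᵒᵖ) (y : I) :
    Finsupp.liftAddHom
      (fun k ↦ DistribSMul.toAddMonoidHom I (ψ (Finsupp.single k 1)).unop) (finsuppTmul v y) =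
      (ψ v).unop • y := by
  rw [liftAddHom_finsuppTmul]
  induction v using Finsupp.induction_linear with
  | zero => simp
  | add v w hv hw =>
    rw [Finsupp.sum_add_index', hv, hw, map_add, MulOpposite.unop_add, add_smul]
    · simp
    · intros; simp [add_smul]
  | single k a =>
    have : ψ (Finsupp.single k a) = a * ψ (Finsupp.single k 1) := by
      rw [← smul_eq_mul, ← map_smul, Finsupp.smul_single, smul_eq_mul, mul_one]
    rw [Finsupp.sum_single_index (by simp), this, MulOpposite.unop_mul, mul_smul]
    rfl

/-- The submodule of finitely supported sequences. -/
abbrev finiteSequences (Γ : Type*) [Ring Γ] : Submodule Γ (ℕ → Γ) :=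
  LinearMap.range (Finsupp.lcoeFun : (ℕ →₀ Γ) →ₗ[Γ] (ℕ → Γ))

theorem exists_forall_ge_eq_zero {Γ : Type*} [Ring Γ] {s : ℕ → Γ} (h : s ∈ finiteSequences Γ) :
    ∃ k, ∀ m, k ≤ m → s m = 0 := by
  obtain ⟨t, rfl⟩ := h
  refine ⟨t.support.sup id + 1, fun m hm ↦ ?_⟩
  by_contra hne
  have : m ≤ t.support.sup id := Finset.le_sup (f := id) (Finsupp.mem_support_iff.2 hne)
  lia

theorem mem_finiteSequences {Γ : Type*} [Ring Γ] {s : ℕ → Γ} {k : ℕ}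
    (h : ∀ m, k ≤ m → s m = 0) : s ∈ finiteSequences Γ := by
  refine ⟨Finsupp.ofSupportFinite s ((Set.finite_lt_nat k).subset fun m hm ↦ ?_), rfl⟩
  by_contra hlt
  exact hm (h m (not_lt.1 hlt))

theorem exists_linearMap_comp_eq {Γ A B C : Type*} [Ring Γ] [AddCommGroup A] [Module Γ A]
    [AddCommGroup B] [Module Γ B] [AddCommGroup C] [Module Γ C] {p : A →ₗ[Γ] B}
    (hp : Function.Surjective p) {f : A →ₗ[Γ] C} (h : LinearMap.ker p ≤ LinearMap.ker f) :
    ∃ g : B →ₗ[Γ] C, g ∘ₗ p = f := by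
  refine ⟨(LinearMap.ker p).liftQ f h ∘ₗ (p.quotKerEquivOfSurjective hp).symm, ?_⟩
  ext x
  have : (p.quotKerEquivOfSurjective hp).symm (p x) = Submodule.Quotient.mk x := by
    rw [LinearEquiv.symm_apply_eq]
    rfl
  simp [this]

theorem Baer.exists_comp_eq {Q A B : Type*} [AddCommGroup Q] [Module Λ Q]
    [AddCommGroup A] [Module Λ A] [AddCommGroup B] [Module Λ B] (hQ : Module.Baer Λ Q)
    {f : A →ₗ[Λ] B} {g : A →ₗ[Λ] Q} (h : LinearMap.ker f ≤ LinearMap.ker g) :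
    ∃ k : B →ₗ[Λ] Q, k ∘ₗ f = g := by
  obtain ⟨k, hk⟩ := hQ.extension_property ((LinearMap.ker f).liftQ f le_rfl)
    (LinearMap.ker_eq_bot.1 (Submodule.ker_liftQ_eq_bot _ _ _ le_rfl))
    ((LinearMap.ker f).liftQ g h)
  refine ⟨k, ?_⟩
  ext x
  exact DFunLike.congr_fun hk (Submodule.Quotient.mk x)

variable {K : Type*} [AddCommGroup K] [Module Λᵐᵒᵖ K]

/-- For a countably presented right module `K` with a homomorphism to a free right module `P` along
which all homomorphisms from `K` to `Λ^ℕ / Λ^(ℕ)` extend, the kernel of `K ⊗ I → P ⊗ I` vanishes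
for every injective left module `I`; here `x` lifts an element of that kernel. -/
theorem exists_eq_sum_finsuppTmul (hI : Module.Baer Λ I) (i : K →ₗ[Λᵐᵒᵖ] (κ →₀ Λᵐᵒᵖ))
    {p : (ι →₀ Λᵐᵒᵖ) →ₗ[Λᵐᵒᵖ] K} (hp : Function.Surjective p) {l : ℕ → (ι →₀ Λᵐᵒᵖ)}
    (hl : LinearMap.ker p = Submodule.span Λᵐᵒᵖ (Set.range l))
    (hX : ∀ f : K →ₗ[Λᵐᵒᵖ] ((ℕ → Λᵐᵒᵖ) ⧸ finiteSequences Λᵐᵒᵖ),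
      ∃ g : (κ →₀ Λᵐᵒᵖ) →ₗ[Λᵐᵒᵖ] ((ℕ → Λᵐᵒᵖ) ⧸ finiteSequences Λᵐᵒᵖ), g ∘ₗ i = f)
    (x : ι →₀ I)
    (hx : (Finsupp.liftAddHom fun j ↦ finsuppTmul (i (p (Finsupp.single j 1)))) x = 0) :
    ∃ (k : ℕ) (y : Fin k → I), x = ∑ m : Fin k, finsuppTmul (l m) (y m) := by
  classical
  -- `T` evaluates a functional `φ` on the element `x`, and `E k` evaluates it on the relations `l
  -- 0, …, l (k - 1)`.
  let T : (ι → Λ) →ₗ[Λ] I :=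
    { toFun := fun φ ↦ x.sum fun j y ↦ φ j • y
      map_add' := fun φ ψ ↦ by simp [add_smul, Finsupp.sum_add]
      map_smul' := fun r φ ↦ by simp [mul_smul, Finsupp.smul_sum] }
  let pairing (φ : ι → Λ) : (ι →₀ Λᵐᵒᵖ) →ₗ[Λᵐᵒᵖ] Λᵐᵒᵖ :=
    Finsupp.linearCombination Λᵐᵒᵖ fun j ↦ MulOpposite.op (φ j)
  let E (k : ℕ) : (ι → Λ) →ₗ[Λ] (Fin k → Λ) :=
    { toFun := fun φ m ↦ (pairing φ (l m)).unop
      map_add' := fun φ ψ ↦ by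
        ext m
        simp [pairing, Finsupp.linearCombination_apply, mul_add, Finsupp.sum_add]
      map_smul' := fun r φ ↦ by
        ext m
        simp only [pairing, Finsupp.linearCombination_apply, Finsupp.sum, Pi.smul_apply,
          smul_eq_mul, MulOpposite.op_mul, RingHom.id_apply, Finset.unop_sum,
          MulOpposite.unop_mul, MulOpposite.unop_op, Finset.mul_sum, mul_assoc] }
  by_cases hk : ∃ k, LinearMap.ker (E k) ≤ LinearMap.ker T
  · obtain ⟨k, hk⟩ := hk
    -- Injectivity of `I` factors `T` through finitely many relations; evaluating on the coordinate
    -- functionals then expresses `x` by these relations.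
    obtain ⟨h, hh⟩ := Baer.exists_comp_eq hI hk
    refine ⟨k, fun m ↦ h (Pi.single m 1), ?_⟩
    ext j
    have h₁ : T (Pi.single j 1) = x j := by
      change (x.sum fun j' y ↦ (Pi.single j 1 : ι → Λ) j' • y) = x j
      rw [Finsupp.sum_eq_single j]
      · simp
      · intro b _ hb
        simp [hb]
      · simp
    have h₂ : E k (Pi.single j 1) = fun m : Fin k ↦ (l m j).unop := by
      ext m
      change (pairing (Pi.single j 1) (l m)).unop = _
      simp only [pairing, Finsupp.linearCombination_apply]
      rw [Finsupp.sum_eq_single j]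
      · simp
      · intro b _ hb
        simp [hb]
      · simp
    rw [← h₁, ← hh, LinearMap.comp_apply, h₂, LinearMap.pi_apply_eq_sum_univ h,
      Finsupp.finsetSum_apply]
    refine Finset.sum_congr rfl fun m _ ↦ ?_
    simp only [finsuppTmul, AddMonoidHom.coe_mk, ZeroHom.coe_mk, Finsupp.mapRange_apply]
    congr 2
    ext m'
    simp [Pi.single_apply, eq_comm]
  · exfalso
    push Not at hk
    simp only [SetLike.not_le_iff_exists, LinearMap.mem_ker] at hk
    choose φ hφ hφT using hk
    -- Otherwise each `φ k` kills the first `k` relations but not `x`. Taken together they send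
    -- every relation to a finite sequence, and so define a homomorphism from `K` to the quotient.
    let Φ : (ι →₀ Λᵐᵒᵖ) →ₗ[Λᵐᵒᵖ] (ℕ → Λᵐᵒᵖ) := LinearMap.pi fun k ↦ pairing (φ k)
    have hΦ : LinearMap.ker p ≤ LinearMap.ker ((finiteSequences Λᵐᵒᵖ).mkQ ∘ₗ Φ) := by
      rw [hl, Submodule.span_le]
      rintro _ ⟨m, rfl⟩
      simp only [SetLike.mem_coe, LinearMap.mem_ker, LinearMap.comp_apply, Submodule.mkQ_apply,
        Submodule.Quotient.mk_eq_zero]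
      refine mem_finiteSequences (k := m + 1) fun k hk ↦ ?_
      exact MulOpposite.unop_injective (congrFun (hφ k) ⟨m, hk⟩)
    obtain ⟨f, hf⟩ := exists_linearMap_comp_eq hp hΦ
    obtain ⟨g, hg⟩ := hX f
    obtain ⟨ψ, hψ⟩ := Module.projective_lifting_property (finiteSequences Λᵐᵒᵖ).mkQ g
      (Submodule.mkQ_surjective _)
    have hmem (j : ι) : Φ (Finsupp.single j 1) - ψ (i (p (Finsupp.single j 1))) ∈
        finiteSequences Λᵐᵒᵖ := by
      rw [← Submodule.Quotient.mk_eq_zero, Submodule.Quotient.mk_sub, sub_eq_zero]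
      have h₁ := DFunLike.congr_fun hf (Finsupp.single j 1)
      have h₂ := DFunLike.congr_fun hg (p (Finsupp.single j 1))
      have h₃ := DFunLike.congr_fun hψ (i (p (Finsupp.single j 1)))
      exact (h₁.symm.trans h₂.symm).trans h₃.symm
    choose N hN using fun j ↦ exists_forall_ge_eq_zero (hmem j)
    -- The extension to the free module lifts to `ψ`, which agrees with `Φ` on each generator in
    -- almost all coordinates. As `x` has finite support, one coordinate `k` works for all
    -- generators involved; there `T (φ k)` depends only on the image of `x` in `P ⊗ I`, which is
    -- zero.
    let k := x.support.sup N
    apply hφT k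
    let ψk : (κ →₀ Λᵐᵒᵖ) →ₗ[Λᵐᵒᵖ] Λᵐᵒᵖ := LinearMap.proj k ∘ₗ ψ
    let S : (κ →₀ I) →+ I := Finsupp.liftAddHom
      fun k ↦ DistribSMul.toAddMonoidHom I (ψk (Finsupp.single k 1)).unop
    rw [← map_zero S, ← hx, Finsupp.liftAddHom_apply (N := κ →₀ I), Finsupp.sum, map_sum]
    refine Finset.sum_congr rfl fun j hj ↦ ?_
    have h₁ := hN j k (Finset.le_sup hj)
    rw [Pi.sub_apply, sub_eq_zero] at h₁
    have h₂ : S (finsuppTmul (i (p (Finsupp.single j 1))) (x j)) =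
        (ψk (i (p (Finsupp.single j 1)))).unop • x j := liftAddHom_smul_finsuppTmul ψk _ _
    have h₃ : Φ (Finsupp.single j 1) k = MulOpposite.op (φ k j) := by
      simp [Φ, pairing]
    rw [h₂, show ψk (i (p (Finsupp.single j 1))) = ψ (i (p (Finsupp.single j 1))) k from rfl,
      ← h₁, h₃, MulOpposite.unop_op]

/-- A homomorphism `K → I⁺` is a character of `K ⊗ I`. By the preceding lemma `K ⊗ I` embeds into `P
⊗ I`, and the character extends since `ℚ/ℤ` is divisible. Here `D` and `F` are the map to `P ⊗ I`
and the character, both lifted to the free cover of `K`. -/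
theorem exists_extension_to_character (hI : Module.Baer Λ I) (i : K →ₗ[Λᵐᵒᵖ] (κ →₀ Λᵐᵒᵖ))
    {p : (ι →₀ Λᵐᵒᵖ) →ₗ[Λᵐᵒᵖ] K} (hp : Function.Surjective p) {l : ℕ → (ι →₀ Λᵐᵒᵖ)}
    (hl : LinearMap.ker p = Submodule.span Λᵐᵒᵖ (Set.range l))
    (hX : ∀ f : K →ₗ[Λᵐᵒᵖ] ((ℕ → Λᵐᵒᵖ) ⧸ finiteSequences Λᵐᵒᵖ),
      ∃ g : (κ →₀ Λᵐᵒᵖ) →ₗ[Λᵐᵒᵖ] ((ℕ → Λᵐᵒᵖ) ⧸ finiteSequences Λᵐᵒᵖ), g ∘ₗ i = f)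
    (f : K →ₗ[Λᵐᵒᵖ] CharacterModule I) :
    ∃ g : (κ →₀ Λᵐᵒᵖ) →ₗ[Λᵐᵒᵖ] CharacterModule I, g ∘ₗ i = f := by
  let D : (ι →₀ I) →+ (κ →₀ I) :=
    Finsupp.liftAddHom fun j ↦ finsuppTmul (i (p (Finsupp.single j 1)))
  let F : (ι →₀ I) →+ AddCircle (1 : ℚ) :=
    Finsupp.liftAddHom fun j ↦ (f (p (Finsupp.single j 1)) : I →+ AddCircle (1 : ℚ))
  have hF (v : ι →₀ Λᵐᵒᵖ) (y : I) : F (finsuppTmul v y) = f (p v) y := by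
    refine (liftAddHom_character_finsuppTmul _ _ _).trans ?_
    congr 1
    change _ = (f ∘ₗ p) v
    congr 1
    ext j : 2
    simp
  have hker : D.ker ≤ F.ker := by
    intro x hx
    obtain ⟨k, y, rfl⟩ := exists_eq_sum_finsuppTmul hI i hp hl hX x hx
    rw [AddMonoidHom.mem_ker, map_sum]
    refine Finset.sum_eq_zero fun m _ ↦ ?_
    have : l m ∈ LinearMap.ker p := hl ▸ Submodule.subset_span ⟨m, rfl⟩
    rw [hF, LinearMap.mem_ker.1 this, map_zero]
    rfl
  obtain ⟨d, hd⟩ := Baer.exists_comp_eq (Module.Baer.of_divisible (AddCircle (1 : ℚ)))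
    (f := D.toIntLinearMap) (g := F.toIntLinearMap) hker
  refine ⟨Finsupp.linearCombination Λᵐᵒᵖ
    fun k ↦ (d.toAddMonoidHom.comp (Finsupp.singleAddHom k) : CharacterModule I), ?_⟩
  rw [← LinearMap.cancel_right hp]
  ext j y
  simp only [LinearMap.comp_apply, Finsupp.lsingle_apply]
  refine (liftAddHom_character_finsuppTmul _ _ y).symm.trans ?_
  have h₁ : (Finsupp.liftAddHom fun k ↦
      d.toAddMonoidHom.comp (Finsupp.singleAddHom k : I →+ κ →₀ I)) = d.toAddMonoidHom := by
    ext; simp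
  have h₂ : D (Finsupp.single j y) = finsuppTmul (i (p (Finsupp.single j 1))) y := by
    simp [D]
  have h₃ : F (Finsupp.single j y) = f (p (Finsupp.single j 1)) y :=
    (Finsupp.liftAddHom_apply_single _ _ _)
  refine (DFunLike.congr_fun h₁ _).trans ?_
  rw [← h₃, ← h₂]
  exact DFunLike.congr_fun hd (Finsupp.single j y)

end CountablyPresented

/-! ### Countably noetherian rings and characters of injective modules -/

section CountablyNoetherian

/-- Countable powers are exact and preserve injectives, so they carry injective resolutions to
injective resolutions. -/
theorem hasInjectiveDimensionLE_pi {Γ : Type u} [Ring Γ] {n : ℕ} (M : Type u) [AddCommGroup M]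
    [Module Γ M] (h : HasInjectiveDimensionLE (ModuleCat.of Γ M) n) :
    HasInjectiveDimensionLE (ModuleCat.of Γ (ℕ → M)) n := by
  have key (E : Type u) [AddCommGroup E] [Module Γ E]
      (h : HasInjectiveDimensionLT (ModuleCat.of Γ E) 1) :
      HasInjectiveDimensionLT (ModuleCat.of Γ (ℕ → E)) 1 := by
    rw [hasInjectiveDimensionLT_one_iff, Module.Baer.iff_injective] at *
    exact Module.Injective.pi Γ fun _ : ℕ ↦ E
  induction n generalizing M with
  | zero => exact key M h
  | succ n ih =>
    obtain ⟨E, f, hE, hf⟩ := exists_injective_embedding (Λ := Γ) M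
    have hC := ih _ (((shortExact_coker hf).hasInjectiveDimensionLT_X₃_iff n hE).2 h)
    have hE' : Injective (ModuleCat.of Γ (ℕ → E)) :=
      injective_iff_hasInjectiveDimensionLT_one.2 (key E inferInstance)
    have hS := shortExact_ofHom (f := f.compLeft ℕ) (g := (LinearMap.range f).mkQ.compLeft ℕ)
      hf.comp_left (Submodule.mkQ_surjective _).comp_left (fun x ↦ by
        constructor
        · intro hx
          choose y hy using fun i ↦ (LinearMap.exact_map_mkQ_range f (x i)).1 (congrFun hx i)
          exact ⟨y, funext hy⟩
        · rintro ⟨y, rfl⟩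
          ext i
          simp)
    exact (hS.hasInjectiveDimensionLT_X₃_iff n hE').1 hC

/-- A ring is countably noetherian if all submodules of the free module of countable rank are
countably generated. -/
def CountablyNoetherian (Γ : Type u) [Ring Γ] : Prop :=
  ∀ N : Submodule Γ (ℕ →₀ Γ), ∃ l : ℕ → (ℕ →₀ Γ), N = Submodule.span Γ (Set.range l)

theorem CountablyNoetherian.exists_surjective {Γ : Type u} [Ring Γ] (hΓ : CountablyNoetherian Γ)
    (N : Submodule Γ (ℕ →₀ Γ)) : ∃ p : (ℕ →₀ Γ) →ₗ[Γ] N, Function.Surjective p := by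
  obtain ⟨l, rfl⟩ := hΓ N
  refine ⟨Finsupp.linearCombination Γ
    fun m ↦ (⟨l m, Submodule.subset_span ⟨m, rfl⟩⟩ : Submodule.span Γ (Set.range l)), ?_⟩
  rw [← LinearMap.range_eq_top, Finsupp.range_linearCombination]
  refine Submodule.map_injective_of_injective (Submodule.subtype_injective _) ?_
  rw [Submodule.map_span, Submodule.map_top, Submodule.range_subtype, ← Set.range_comp]
  rfl

theorem hasInjectiveDimensionLE_sequences_quotient {Γ : Type u} [Ring Γ] {n : ℕ}
    (h : HasInjectiveDimensionLE (ModuleCat.of Γ (ℕ →₀ Γ)) n) :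
    HasInjectiveDimensionLE (ModuleCat.of Γ ((ℕ → Γ) ⧸ finiteSequences Γ)) n := by
  have h₁ : HasInjectiveDimensionLE (ModuleCat.of Γ Γ) n :=
    (retractOfComp (i := Finsupp.lsingle (R := Γ) 0) (r := Finsupp.lapply (M := Γ) (0 : ℕ))
      (by ext; simp)).hasInjectiveDimensionLT (n + 1)
  have h₂ := hasInjectiveDimensionLE_pi Γ h₁
  have hS := shortExact_coker (f := (Finsupp.lcoeFun : (ℕ →₀ Γ) →ₗ[Γ] (ℕ → Γ)))
    DFunLike.coe_injective
  exact hS.hasInjectiveDimensionLT_X₃ (n + 1) h₂ (hasInjectiveDimensionLT_of_ge _ (n + 1) _ (by lia))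

/-- Over a countably noetherian opposite ring, vanishing of the `Ext` groups of a countably
generated right module with coefficients in `Λ^ℕ / Λ^(ℕ)` implies vanishing with coefficients in the
character modules of injective left modules. -/
theorem subsingleton_ext_character {Λ : Type u} [Ring Λ] (hΛ : CountablyNoetherian Λᵐᵒᵖ)
    {I : Type u} [AddCommGroup I] [Module Λ I] (hI : Module.Baer Λ I) (n : ℕ)
    {A : ModuleCat.{u} Λᵐᵒᵖ} {q : (ℕ →₀ Λᵐᵒᵖ) →ₗ[Λᵐᵒᵖ] A} (hq : Function.Surjective q)
    (h : Subsingleton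
      (Ext A (ModuleCat.of Λᵐᵒᵖ ((ℕ → Λᵐᵒᵖ) ⧸ finiteSequences Λᵐᵒᵖ)) (n + 1))) :
    Subsingleton (Ext A (ModuleCat.of Λᵐᵒᵖ (CharacterModule I)) (n + 1)) := by
  have hP : Projective (ModuleCat.of Λᵐᵒᵖ (ℕ →₀ Λᵐᵒᵖ)) :=
    ModuleCat.projective_of_categoryTheory_projective _
  have hS := shortExact_ker hq
  obtain ⟨p, hp⟩ := hΛ.exists_surjective (LinearMap.ker q)
  induction n generalizing A with
  | zero =>
    refine (subsingleton_ext_one_iff hS _).2 fun f ↦ ?_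
    obtain ⟨l, hl⟩ := hΛ (LinearMap.ker p)
    obtain ⟨g, hg⟩ := exists_extension_to_character hI (LinearMap.ker q).subtype hp hl
      (fun f ↦ by
        obtain ⟨g, hg⟩ := (subsingleton_ext_one_iff hS _).1 h (ModuleCat.ofHom f)
        exact ⟨g.hom, congrArg ModuleCat.Hom.hom hg⟩) f.hom
    exact ⟨ModuleCat.ofHom g, ModuleCat.hom_ext hg⟩
  | succ n ih =>
    obtain ⟨p', hp'⟩ := hΛ.exists_surjective (LinearMap.ker p)
    exact (subsingleton_ext_X₁_iff hS _ n).1 (ih (A := ModuleCat.of _ _) hp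
      ((subsingleton_ext_X₁_iff hS _ n).2 h) (shortExact_ker hp) p' hp')

theorem hasInjectiveDimensionLE_character {Λ : Type u} [Ring Λ] (hΛ : CountablyNoetherian Λᵐᵒᵖ)
    {n : ℕ} (h : HasInjectiveDimensionLE (ModuleCat.of Λᵐᵒᵖ (ℕ →₀ Λᵐᵒᵖ)) n)
    {I : Type u} [AddCommGroup I] [Module Λ I] (hI : Module.Baer Λ I) :
    HasInjectiveDimensionLE (ModuleCat.of Λᵐᵒᵖ (CharacterModule I)) n := by
  refine hasInjectiveDimensionLE_of_cyclic n _ fun J ↦ ?_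
  have := hasInjectiveDimensionLE_sequences_quotient h
  -- The cyclic module is covered by the free module of countable rank through the coordinate 0, so
  -- that all its successive syzygies are again countably generated.
  refine subsingleton_ext_character hΛ hI n (A := ModuleCat.of _ _)
    (q := J.mkQ ∘ₗ Finsupp.lapply (0 : ℕ)) ?_
    (HasInjectiveDimensionLT.subsingleton _ (n + 1) (n + 1) le_rfl _)
  exact (Submodule.mkQ_surjective J).comp fun x ↦ ⟨Finsupp.single 0 x, by simp⟩

/-- An algebra over a noetherian ring that is countably generated as a module is countably
noetherian. -/
theorem countablyNoetherian_of_countable_span (R : Type v) [CommRing R] [IsNoetherianRing R]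
    (Γ : Type u) [Ring Γ] [Algebra R Γ] (e : ℕ → Γ) (he : Submodule.span R (Set.range e) = ⊤) :
    CountablyNoetherian Γ := by
  intro N
  obtain ⟨b, hb⟩ : ∃ b : ℕ → (ℕ →₀ Γ), Submodule.span R (Set.range b) = ⊤ := by
    refine ⟨fun n ↦ Finsupp.single n.unpair.1 (e n.unpair.2), ?_⟩
    rw [eq_top_iff]
    rintro x -
    induction x using Finsupp.induction_linear with
    | zero => exact zero_mem _
    | add x y hx hy => exact add_mem hx hy
    | single n a =>
      have ha : a ∈ Submodule.span R (Set.range e) := he ▸ Submodule.mem_top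
      have := Submodule.mem_map_of_mem (f := Finsupp.lsingle (R := R) n) ha
      rw [Submodule.map_span] at this
      refine Submodule.span_mono ?_ this
      rintro _ ⟨_, ⟨m, rfl⟩, rfl⟩
      exact ⟨Nat.pair n m, by simp⟩
  let M (k : ℕ) : Submodule R (ℕ →₀ Γ) := Submodule.span R (b '' Set.Iio k)
  have hM (x : ℕ →₀ Γ) : ∃ k, x ∈ M k := by
    have hx : x ∈ Submodule.span R (Set.range b) := hb ▸ Submodule.mem_top
    rw [← Set.image_univ, ← Set.iUnion_Iio, Set.image_iUnion, Submodule.span_iUnion,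
      Submodule.mem_iSup_of_directed] at hx
    · exact hx
    · exact Monotone.directed_le fun i j hij ↦
        Submodule.span_mono (Set.image_mono (Set.Iio_subset_Iio hij))
  -- The free module is exhausted by the finitely generated `R`-modules `M k`, and `R` is
  -- noetherian; generators of all the intersections with `N` form a countable set.
  have hfg (k : ℕ) : (N.restrictScalars R ⊓ M k).FG := by
    have : IsNoetherian R (M k) := isNoetherian_of_fg_of_noetherian _
      (Submodule.fg_span ((Set.finite_Iio k).image b))
    have := (isNoetherian_submodule.1 this) (N.restrictScalars R ⊓ M k) inf_le_right
    exact this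
  choose t ht using hfg
  -- Zero is added only to have a nonempty set, which a sequence can enumerate.
  have hc : (insert 0 (⋃ k, (t k : Set (ℕ →₀ Γ)))).Countable :=
    (Set.countable_iUnion fun k ↦ (t k).countable_toSet).insert 0
  obtain ⟨l, hl⟩ := hc.exists_eq_range (Set.insert_nonempty _ _)
  refine ⟨l, ?_⟩
  rw [← hl, Submodule.span_insert_zero]
  refine le_antisymm (fun x hx ↦ ?_) (Submodule.span_le.2 (Set.iUnion_subset fun k x hx ↦ ?_))
  · obtain ⟨k, hk⟩ := hM x
    have h₁ : x ∈ Submodule.span R (t k : Set (ℕ →₀ Γ)) := ht k ▸ ⟨hx, hk⟩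
    exact Submodule.span_mono (Set.subset_iUnion _ k)
      (Submodule.span_le_restrictScalars R Γ _ h₁)
  · have h₁ : x ∈ Submodule.span R (t k : Set (ℕ →₀ Γ)) := Submodule.subset_span hx
    rw [ht k] at h₁
    exact h₁.1

end CountablyNoetherian

/-! ### Diagonal actions on Hom, and restriction of injectives to subgroups -/

section Diagonal

open Representation

variable {R : Type*} [CommRing R] {G : Type*} [Group G]

theorem single_smul_ofModule' {M : Type*} [AddCommGroup M] [Module R M]
    [Module (MonoidAlgebra R G) M] [IsScalarTower R (MonoidAlgebra R G) M] (g : G) (m : M) :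
    ofModule' (k := R) (G := G) M g m = MonoidAlgebra.single g (1 : R) • m := rfl

/-- The `R`-module `Hom_R(M, N)` with the diagonal action of `G`. -/
abbrev DiagonalHom (M : Type*) [AddCommGroup M] [Module R M] [Module (MonoidAlgebra R G) M]
    [IsScalarTower R (MonoidAlgebra R G) M] {N : Type*} [AddCommGroup N] [Module R N]
    (σ : Representation R G N) : Type _ :=
  (linHom (ofModule' (k := R) (G := G) M) σ).asModule

variable {M : Type*} [AddCommGroup M] [Module R M] [Module (MonoidAlgebra R G) M]
  [IsScalarTower R (MonoidAlgebra R G) M] {N : Type*} [AddCommGroup N] [Module R N]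

namespace DiagonalHom

/-- The linear map underlying an element of `Hom_R(M, N)`. -/
def toLinearMap (σ : Representation R G N) : DiagonalHom M σ ≃ₗ[R] (M →ₗ[R] N) :=
  asModuleEquiv _

variable {σ : Representation R G N}

theorem toLinearMap_single_smul (g : G) (f : DiagonalHom M σ) (m : M) :
    toLinearMap σ (MonoidAlgebra.single g (1 : R) • f) m =
      σ g (toLinearMap σ f (MonoidAlgebra.single g⁻¹ (1 : R) • m)) := by
  rw [toLinearMap, asModuleEquiv_map_smul, asAlgebraHom_single, one_smul]
  rfl

/-- An `R`-linear map into `Hom_R(M, N)` that is compatible with the diagonal action. -/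
def mkLinear {X : Type*} [AddCommGroup X] [Module R X] [Module (MonoidAlgebra R G) X]
    [IsScalarTower R (MonoidAlgebra R G) X] (f : X →ₗ[R] (M →ₗ[R] N))
    (hf : ∀ (g : G) (x : X) (m : M), f (MonoidAlgebra.single g (1 : R) • x) m =
      σ g (f x (MonoidAlgebra.single g⁻¹ (1 : R) • m))) :
    X →ₗ[MonoidAlgebra R G] DiagonalHom M σ :=
  MonoidAlgebra.equivariantOfLinearOfComm ((toLinearMap σ).symm.toLinearMap ∘ₗ f) fun g x ↦ by
    apply (toLinearMap σ).injective
    ext m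
    rw [toLinearMap_single_smul]
    simp [hf]

/-- `Hom_R(M, N)` is an injective module over the group ring if `M` is free over the group ring
and `N` is injective over `R`. -/
theorem baer [Module.Free (MonoidAlgebra R G) M] (hN : Module.Baer R N) :
    Module.Baer (MonoidAlgebra R G) (DiagonalHom M σ) := by
  intro J f
  let c := Module.Free.chooseBasis (MonoidAlgebra R G) M
  let b := (MonoidAlgebra.basis G R).smulTower c
  have hb (g h : G) (t) : MonoidAlgebra.single g (1 : R) • b (h, t) = b (g * h, t) := by
    simp only [b, Module.Basis.smulTower_apply, ← mul_smul, MonoidAlgebra.basis_apply,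
      MonoidAlgebra.single_mul_single, one_mul]
  have hc (h : G) (t) : b (h, t) = MonoidAlgebra.single h (1 : R) • c t := by
    simp [b, Module.Basis.smulTower_apply]
  -- An equivariant `f` is determined by its values on the RG-basis `c`, that is, by the `R`-linear
  -- maps `u t`, which extend to RG because `N` is injective over `R`.
  let u (t) : J →ₗ[R] N :=
    { toFun := fun x ↦ toLinearMap σ (f x) (c t)
      map_add' := fun x y ↦ by simp
      map_smul' := fun r x ↦ by
        have : f (r • x) = r • f x := LinearMap.map_smul_of_tower f r x
        simp [this] }
  choose u' hu' using fun t ↦ hN.extension_property (J.subtype.restrictScalars R)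
    (Submodule.subtype_injective J) (u t)
  -- `F₀` is the image of 1 under the extension of `f`; untwisting the action dictates its values on
  -- `b (h, t) = h • c t`.
  let F₀ : DiagonalHom M σ := (toLinearMap σ).symm
    (b.constr R fun p ↦ σ p.1 (u' p.2 (MonoidAlgebra.single p.1⁻¹ 1)))
  have hF₀ (x : MonoidAlgebra R G) (h : G) (t) : toLinearMap σ (x • F₀) (b (h, t)) =
      σ h (u' t (MonoidAlgebra.single h⁻¹ 1 * x)) := by
    induction x using MonoidAlgebra.induction_linear with
    | zero => simp
    | add x y hx hy => simp only [add_smul, map_add, LinearMap.add_apply, hx, hy, mul_add]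
    | single g r =>
      have : MonoidAlgebra.single g r = r • MonoidAlgebra.single g (1 : R) := by simp
      rw [this, smul_assoc, map_smul, LinearMap.smul_apply, toLinearMap_single_smul, hb,
        mul_smul_comm, map_smul, map_smul]
      congr 1
      simp only [F₀, LinearEquiv.apply_symm_apply, Module.Basis.constr_basis, mul_inv_rev,
        inv_inv, MonoidAlgebra.single_mul_single, one_mul]
      rw [← Module.End.mul_apply, ← map_mul, mul_inv_cancel_left]
  refine ⟨LinearMap.toSpanSingleton _ _ F₀, fun x hx ↦ ?_⟩
  apply (toLinearMap σ).injective
  refine b.ext fun ⟨h, t⟩ ↦ ?_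
  rw [LinearMap.toSpanSingleton_apply, hF₀]
  have h₁ : u' t (MonoidAlgebra.single h⁻¹ 1 * x) =
      u t (MonoidAlgebra.single h⁻¹ (1 : R) • ⟨x, hx⟩) :=
    DFunLike.congr_fun (hu' t) (MonoidAlgebra.single h⁻¹ (1 : R) • ⟨x, hx⟩)
  have h₂ : u t (MonoidAlgebra.single h⁻¹ (1 : R) • ⟨x, hx⟩) =
      σ h⁻¹ (toLinearMap σ (f ⟨x, hx⟩) (b (h, t))) := by
    change toLinearMap σ (f (MonoidAlgebra.single h⁻¹ (1 : R) • ⟨x, hx⟩)) (c t) = _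
    rw [map_smul, toLinearMap_single_smul, inv_inv, hc]
  rw [h₁, h₂, self_inv_apply]

end DiagonalHom

/-- A module over the group ring with an `R`-basis permuted freely by the group is free. -/
theorem free_of_basis {M : Type*} [AddCommGroup M] [Module R M] [Module (MonoidAlgebra R G) M]
    [IsScalarTower R (MonoidAlgebra R G) M] {T : Type*} (b : Module.Basis (G × T) R M)
    (hb : ∀ g h t, MonoidAlgebra.single g (1 : R) • b (h, t) = b (g * h, t)) :
    Module.Free (MonoidAlgebra R G) M := by
  let e : (T →₀ MonoidAlgebra R G) →ₗ[MonoidAlgebra R G] M :=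
    Finsupp.linearCombination _ fun t ↦ b (1, t)
  let e' : M →ₗ[R] (T →₀ MonoidAlgebra R G) :=
    b.constr R fun p ↦ Finsupp.single p.2 (MonoidAlgebra.single p.1 1)
  have he (t : T) (g : G) : e (Finsupp.single t (MonoidAlgebra.single g 1)) = b (g, t) := by
    simp [e, hb]
  have h₁ : (e.restrictScalars R) ∘ₗ e' = LinearMap.id := by
    refine b.ext fun p ↦ ?_
    simp [e', he]
  have h₂ : e' ∘ₗ (e.restrictScalars R) = LinearMap.id := by
    refine Finsupp.lhom_ext' fun t ↦ (MonoidAlgebra.basis G R).ext fun g ↦ ?_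
    simp [e', he, MonoidAlgebra.basis_apply]
  have hinj : Function.Injective e :=
    Function.LeftInverse.injective (g := e') fun x ↦ DFunLike.congr_fun h₂ x
  have hsurj : Function.Surjective e :=
    Function.RightInverse.surjective (g := e') fun x ↦ DFunLike.congr_fun h₁ x
  exact .of_equiv (LinearEquiv.ofBijective e ⟨hinj, hsurj⟩)

/-- An injective module over the group ring is injective over `R`. -/
theorem baer_restrict_base {Q : Type*} [AddCommGroup Q] [Module R Q]
    [Module (MonoidAlgebra R G) Q] [IsScalarTower R (MonoidAlgebra R G) Q]
    (hQ : Module.Baer (MonoidAlgebra R G) Q) : Module.Baer R Q := by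
  intro J f
  let f' : (MonoidAlgebra R G) ⊗[R] J →ₗ[MonoidAlgebra R G] Q :=
    TensorProduct.AlgebraTensorModule.lift (LinearMap.toSpanSingleton (MonoidAlgebra R G) _ f)
  -- RG is flat over `R`, so induction keeps the inclusion of the ideal injective.
  obtain ⟨g, hg⟩ := hQ.extension_property
    (TensorProduct.AlgebraTensorModule.lTensor (MonoidAlgebra R G) (MonoidAlgebra R G) J.subtype)
    (Module.Flat.lTensor_preserves_injective_linearMap _ (Submodule.subtype_injective J)) f'
  refine ⟨(g.restrictScalars R) ∘ₗ TensorProduct.mk R (MonoidAlgebra R G) R 1, fun x hx ↦ ?_⟩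
  have := DFunLike.congr_fun hg (1 ⊗ₜ ⟨x, hx⟩)
  simpa [f'] using this

/-- The augmentation of the group ring. -/
def augmentation (R G : Type*) [CommRing R] [Group G] : MonoidAlgebra R G →ₐ[R] R :=
  MonoidAlgebra.lift R R G 1

theorem augmentation_single (g : G) (r : R) : augmentation R G (MonoidAlgebra.single g r) = r := by
  simp [augmentation]

theorem augmentation_single_smul (g : G) (x : MonoidAlgebra R G) :
    augmentation R G (MonoidAlgebra.single g (1 : R) • x) = augmentation R G x := by
  rw [smul_eq_mul, map_mul, augmentation_single, one_mul]

/-- The map from `Q` to `Hom_R(RG, Q)` with values the multiples of the augmentation. -/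
abbrev constantHom (R G Q : Type*) [CommRing R] [Group G] [AddCommGroup Q] [Module R Q] :
    Q →ₗ[R] (MonoidAlgebra R G →ₗ[R] Q) :=
  LinearMap.smulRightₗ (augmentation R G).toLinearMap

theorem constantHom_apply {Q : Type*} [AddCommGroup Q] [Module R Q] (q : Q)
    (x : MonoidAlgebra R G) : constantHom R G Q q x = augmentation R G x • q := rfl

theorem constantHom_injective (Q : Type*) [AddCommGroup Q] [Module R Q] :
    Function.Injective (constantHom R G Q) := by
  intro p q h
  have := DFunLike.congr_fun h 1
  simpa [constantHom_apply] using this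

theorem constantHom_equivariant {Q : Type*} [AddCommGroup Q] [Module R Q]
    [Module (MonoidAlgebra R G) Q] [IsScalarTower R (MonoidAlgebra R G) Q] (g : G) (q : Q)
    (x : MonoidAlgebra R G) :
    constantHom R G Q (MonoidAlgebra.single g (1 : R) • q) x =
      ofModule' (k := R) (G := G) Q g
        (constantHom R G Q q (MonoidAlgebra.single g⁻¹ (1 : R) • x)) := by
  rw [constantHom_apply, constantHom_apply, augmentation_single_smul, map_smul,
    single_smul_ofModule']

section Subgroup

variable (H : Subgroup G)

/-- The inclusion of the group ring of a subgroup. -/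
abbrev subgroupHom (R : Type*) [CommRing R] {G : Type*} [Group G] (H : Subgroup G) :
    MonoidAlgebra R H →ₐ[R] MonoidAlgebra R G :=
  MonoidAlgebra.mapDomainAlgHom R R H.subtype

theorem subgroupHom_single (h : H) (r : R) :
    subgroupHom R H (MonoidAlgebra.single h r) = MonoidAlgebra.single (h : G) r := by
  simp [subgroupHom]

theorem free_subgroup [Module (MonoidAlgebra R H) (MonoidAlgebra R G)]
    [IsScalarTower R (MonoidAlgebra R H) (MonoidAlgebra R G)]
    (hsmul : ∀ (h : H) (x : MonoidAlgebra R G), MonoidAlgebra.single h (1 : R) • x =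
      MonoidAlgebra.single (h : G) (1 : R) * x) :
    Module.Free (MonoidAlgebra R H) (MonoidAlgebra R G) := by
  -- Inverting representatives of left cosets yields representatives of right cosets, along which
  -- `G` is a free left `H`-set.
  let f (p : H × (G ⧸ H)) : G := p.1 * p.2.out⁻¹
  have hf : Function.Bijective f := by
    constructor
    · rintro ⟨h, t⟩ ⟨h', t'⟩ heq
      have h₁ : t.out * (h⁻¹ : H) = t'.out * (h'⁻¹ : H) := by
        simpa [f] using congrArg (·⁻¹) heq
      have h₂ := congrArg (QuotientGroup.mk (s := H)) h₁
      rw [QuotientGroup.mk_mul_of_mem _ (SetLike.coe_mem _),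
        QuotientGroup.mk_mul_of_mem _ (SetLike.coe_mem _), QuotientGroup.out_eq',
        QuotientGroup.out_eq'] at h₂
      subst h₂
      simpa using h₁
    · intro g
      obtain ⟨k, hk⟩ := QuotientGroup.mk_out_eq_mul H g⁻¹
      exact ⟨(k, QuotientGroup.mk g⁻¹), by simp [f, hk]⟩
  let e := (Equiv.ofBijective f hf).symm
  have he (g h : H) (t : G ⧸ H) : e.symm (g * h, t) = g * e.symm (h, t) := by
    simp [e, f, mul_assoc]
  refine free_of_basis ((MonoidAlgebra.basis G R).reindex e) fun g h t ↦ ?_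
  rw [hsmul]
  simp [MonoidAlgebra.basis_apply, he]

/-- An injective module over the group ring is injective over the group ring of a subgroup. -/
theorem baer_restrict_subgroup {Q : Type*} [AddCommGroup Q] [Module R Q]
    [Module (MonoidAlgebra R G) Q] [IsScalarTower R (MonoidAlgebra R G) Q]
    [Module (MonoidAlgebra R H) Q] [IsScalarTower R (MonoidAlgebra R H) Q]
    (hsmul : ∀ (h : H) (q : Q), MonoidAlgebra.single h (1 : R) • q =
      MonoidAlgebra.single (h : G) (1 : R) • q)
    (hQ : Module.Baer (MonoidAlgebra R G) Q) : Module.Baer (MonoidAlgebra R H) Q := by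
  let : Module (MonoidAlgebra R H) (MonoidAlgebra R G) :=
    Module.compHom _ (subgroupHom R H).toRingHom
  have hst (h : H) (x : MonoidAlgebra R G) : MonoidAlgebra.single h (1 : R) • x =
      MonoidAlgebra.single (h : G) (1 : R) * x :=
    congrArg (· * x) (subgroupHom_single H h 1)
  have : IsScalarTower R (MonoidAlgebra R H) (MonoidAlgebra R G) := ⟨fun r a x ↦ by
    change subgroupHom R H (r • a) * x = r • (subgroupHom R H a * x)
    rw [map_smul, smul_mul_assoc]⟩
  have := free_subgroup H hst
  -- The constant embedding of `Q` into `Hom_R(RG, Q)` splits over RG as `Q` is injective.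
  -- Restricted to `H`, its target is injective because RG is free over RH, and the splitting
  -- remains equivariant.
  let jG : Q →ₗ[MonoidAlgebra R G] DiagonalHom (MonoidAlgebra R G) (ofModule' (k := R) Q) :=
    DiagonalHom.mkLinear (constantHom R G Q) constantHom_equivariant
  have hjG : Function.Injective jG := constantHom_injective Q
  obtain ⟨r, hr⟩ := hQ.extension_property jG hjG LinearMap.id
  let jH : Q →ₗ[MonoidAlgebra R H]
      DiagonalHom (MonoidAlgebra R G) (ofModule' (k := R) (G := H) Q) :=
    DiagonalHom.mkLinear (constantHom R G Q) fun h q x ↦ by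
      rw [hsmul, constantHom_equivariant, single_smul_ofModule', single_smul_ofModule', hsmul, hst]
      rfl
  let T : DiagonalHom (MonoidAlgebra R G) (ofModule' (k := R) (G := H) Q) →ₗ[R] Q :=
    (r.restrictScalars R) ∘ₗ (DiagonalHom.toLinearMap _).symm.toLinearMap ∘ₗ
      (DiagonalHom.toLinearMap _).toLinearMap
  let rH : DiagonalHom (MonoidAlgebra R G) (ofModule' (k := R) (G := H) Q) →ₗ[MonoidAlgebra R H]
      Q := MonoidAlgebra.equivariantOfLinearOfComm T fun h f ↦ by
    rw [hsmul]
    simp only [T, LinearMap.comp_apply, LinearMap.restrictScalars_apply, LinearEquiv.coe_coe,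
      ← map_smul]
    congr 1
    apply (DiagonalHom.toLinearMap _).injective
    refine LinearMap.ext fun x ↦ ?_
    rw [LinearEquiv.apply_symm_apply, DiagonalHom.toLinearMap_single_smul,
      DiagonalHom.toLinearMap_single_smul, LinearEquiv.apply_symm_apply,
      single_smul_ofModule', single_smul_ofModule', hsmul, hst]
    rfl
  have hB : Module.Baer (MonoidAlgebra R H)
      (DiagonalHom (MonoidAlgebra R G) (ofModule' (k := R) (G := H) Q)) :=
    DiagonalHom.baer (baer_restrict_base hQ)
  exact baer_of_retract (i := jH) (r := rH) (LinearMap.ext fun q ↦ DFunLike.congr_fun hr q) hB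

end Subgroup

end Diagonal

/-! ### Restriction to subgroups and injective dimension -/

section Restriction

/-- An exact functor that preserves injective objects does not increase the injective dimension. -/
theorem hasInjectiveDimensionLE_map {C D : Type*} [Category C] [Category D] [Abelian C]
    [Abelian D] [EnoughInjectives C] (F : C ⥤ D) [F.PreservesZeroMorphisms]
    [Limits.PreservesFiniteLimits F] [Limits.PreservesFiniteColimits F]
    (hF : ∀ E : C, Injective E → Injective (F.obj E)) {n : ℕ} {X : C}
    (h : HasInjectiveDimensionLE X n) : HasInjectiveDimensionLE (F.obj X) n := by
  induction n generalizing X with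
  | zero =>
    exact injective_iff_hasInjectiveDimensionLT_one.1
      (hF X (injective_iff_hasInjectiveDimensionLT_one.2 h))
  | succ n ih =>
    let S : ShortComplex C := ShortComplex.mk (Injective.ι X) (Limits.cokernel.π (Injective.ι X))
      (Limits.cokernel.condition _)
    have hS : S.ShortExact :=
      { exact := ShortComplex.exact_of_g_is_cokernel _ (Limits.cokernelIsCokernel _) }
    have h₁ := ih ((hS.hasInjectiveDimensionLT_X₃_iff n (Injective.injective_under X)).2 h)
    exact ((hS.map_of_exact F).hasInjectiveDimensionLT_X₃_iff n
      (hF _ (Injective.injective_under X))).1 h₁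

theorem restrictScalars_map_exact {Γ Λ : Type*} [Ring Γ] [Ring Λ] (φ : Γ →+* Λ)
    (S : ShortComplex (ModuleCat.{w} Λ)) (h : S.Exact) :
    (S.map (ModuleCat.restrictScalars.{w} φ)).Exact := by
  rw [CategoryTheory.ShortComplex.ShortExact.moduleCat_exact_iff_function_exact] at h ⊢
  exact h

theorem hasInjectiveDimensionLE_restrictScalars {Γ Λ : Type u} [Ring Γ] [Ring Λ] (φ : Γ →+* Λ)
    (hφ : ∀ E : ModuleCat.{u} Λ, Injective E → Injective ((ModuleCat.restrictScalars φ).obj E))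
    {n : ℕ} {M : ModuleCat.{u} Λ} (h : HasInjectiveDimensionLE M n) :
    HasInjectiveDimensionLE ((ModuleCat.restrictScalars φ).obj M) n := by
  obtain ⟨_, _⟩ := ((CategoryTheory.Functor.exact_tfae
    (ModuleCat.restrictScalars.{u} φ)).out 1 3).mp (restrictScalars_map_exact φ)
  exact hasInjectiveDimensionLE_map _ hφ h

variable {R : Type u} [CommRing R] {G : Type v} [Group G] (H : Subgroup G)

/-- The restriction of a module over the group ring to a subgroup. -/
abbrev restrictModule (M : Type*) [AddCommGroup M] [Module (MonoidAlgebra R G) M] :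
    Module (MonoidAlgebra R H) M :=
  Module.compHom M (subgroupHom R H).toRingHom

theorem restrictModule_smul {M : Type*} [AddCommGroup M] [Module (MonoidAlgebra R G) M]
    (a : MonoidAlgebra R H) (m : M) :
    letI := restrictModule H (R := R) M
    a • m = subgroupHom R H a • m := rfl

theorem baer_restrictModule {Q : Type*} [AddCommGroup Q] [Module (MonoidAlgebra R G) Q]
    (hQ : Module.Baer (MonoidAlgebra R G) Q) :
    letI := restrictModule H (R := R) Q
    Module.Baer (MonoidAlgebra R H) Q := by
  let := restrictModule H (R := R) Q
  let : Module R Q := Module.compHom Q (algebraMap R (MonoidAlgebra R G))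
  have : IsScalarTower R (MonoidAlgebra R G) Q := ⟨fun r a x ↦ by
    rw [Algebra.smul_def, mul_smul]
    rfl⟩
  have : IsScalarTower R (MonoidAlgebra R H) Q := ⟨fun r a x ↦ by
    rw [restrictModule_smul, map_smul, smul_assoc, restrictModule_smul]⟩
  exact baer_restrict_subgroup H (fun h q ↦ by rw [restrictModule_smul, subgroupHom_single]) hQ

theorem hasInjectiveDimensionLE_restrictModule {n : ℕ} {M : Type (max u v)} [AddCommGroup M]
    [Module (MonoidAlgebra R G) M]
    (h : HasInjectiveDimensionLE (ModuleCat.of (MonoidAlgebra R G) M) n) :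
    letI := restrictModule H (R := R) M
    HasInjectiveDimensionLE (ModuleCat.of (MonoidAlgebra R H) M) n := by
  refine hasInjectiveDimensionLE_restrictScalars (subgroupHom R H).toRingHom (fun E hE ↦ ?_) h
  have h₁ : Module.Baer (MonoidAlgebra R G) E :=
    hasInjectiveDimensionLT_one_iff.1 (injective_iff_hasInjectiveDimensionLT_one.1 hE)
  let := restrictModule H (R := R) E
  exact injective_iff_hasInjectiveDimensionLT_one.2
    (hasInjectiveDimensionLT_one_iff.2 (baer_restrictModule H h₁))

theorem projective_restrictModule_finsupp (ι : Type*) :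
    letI := restrictModule H (R := R) (ι →₀ MonoidAlgebra R G)
    Module.Projective (MonoidAlgebra R H) (ι →₀ MonoidAlgebra R G) := by
  let := restrictModule H (R := R) (MonoidAlgebra R G)
  have : IsScalarTower R (MonoidAlgebra R H) (MonoidAlgebra R G) := ⟨fun r a x ↦ by
    rw [restrictModule_smul, map_smul, smul_assoc, restrictModule_smul]⟩
  have := free_subgroup H (R := R) fun h x ↦ by
    rw [restrictModule_smul, subgroupHom_single, smul_eq_mul]
  exact inferInstanceAs (Module.Projective (MonoidAlgebra R H) (ι →₀ MonoidAlgebra R G))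

/-- The projection of the group ring onto the group ring of a subgroup. -/
def subgroupProjection : MonoidAlgebra R G →ₗ[R] MonoidAlgebra R H :=
  open scoped Classical in
  (MonoidAlgebra.basis G R).constr R fun g ↦
    if hg : g ∈ H then MonoidAlgebra.single ⟨g, hg⟩ 1 else 0

theorem subgroupProjection_single [DecidablePred (· ∈ H)] (g : G) (r : R) :
    subgroupProjection H (MonoidAlgebra.single g r) =
      if hg : g ∈ H then MonoidAlgebra.single ⟨g, hg⟩ r else 0 := by
  classical
  have : MonoidAlgebra.single g r = r • MonoidAlgebra.basis G R g := by
    simp [MonoidAlgebra.basis_apply]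
  rw [this, map_smul, subgroupProjection, Module.Basis.constr_basis]
  by_cases hg : g ∈ H <;> simp [hg]

theorem subgroupProjection_subgroupHom (x : MonoidAlgebra R H) :
    subgroupProjection H (subgroupHom R H x) = x := by
  classical
  induction x using MonoidAlgebra.induction_linear with
  | zero => simp
  | add a b ha hb => simp only [map_add, ha, hb]
  | single h r => rw [subgroupHom_single, subgroupProjection_single, dif_pos h.2]

theorem subgroupProjection_mul (a : MonoidAlgebra R H) (x : MonoidAlgebra R G) :
    subgroupProjection H (subgroupHom R H a * x) = a * subgroupProjection H x := by
  classical
  induction a using MonoidAlgebra.induction_linear with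
  | zero => simp
  | add a b ha hb => simp only [map_add, add_mul, ha, hb]
  | single h r =>
    induction x using MonoidAlgebra.induction_linear with
    | zero => simp
    | add x y hx hy => simp only [map_add, mul_add, hx, hy]
    | single g s =>
      rw [subgroupHom_single, MonoidAlgebra.single_mul_single, subgroupProjection_single,
        subgroupProjection_single]
      by_cases hg : g ∈ H
      · rw [dif_pos hg, dif_pos (mul_mem h.2 hg), MonoidAlgebra.single_mul_single]
        rfl
      · rw [dif_neg hg, dif_neg (by rwa [Subgroup.mul_mem_cancel_left H h.2]), mul_zero]

/-- Restriction preserves the bound, and discarding the group elements outside `H` is an RH-linear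
retraction of RG onto RH. -/
theorem hasInjectiveDimensionLE_subgroup {n : ℕ}
    (h : HasInjectiveDimensionLE (ModuleCat.of (MonoidAlgebra R G) (ℕ →₀ MonoidAlgebra R G)) n) :
    HasInjectiveDimensionLE (ModuleCat.of (MonoidAlgebra R H) (ℕ →₀ MonoidAlgebra R H)) n := by
  let := restrictModule H (R := R) (ℕ →₀ MonoidAlgebra R G)
  have h₁ := hasInjectiveDimensionLE_restrictModule H h
  let i : (ℕ →₀ MonoidAlgebra R H) →ₗ[MonoidAlgebra R H] (ℕ →₀ MonoidAlgebra R G) :=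
    { Finsupp.mapRange.addMonoidHom (subgroupHom R H : MonoidAlgebra R H →+ MonoidAlgebra R G) with
      map_smul' := fun a x ↦ by
        ext1 k
        exact map_mul (subgroupHom R H) a (x k) }
  let r : (ℕ →₀ MonoidAlgebra R G) →ₗ[MonoidAlgebra R H] (ℕ →₀ MonoidAlgebra R H) :=
    { Finsupp.mapRange.addMonoidHom (subgroupProjection H (R := R)).toAddMonoidHom with
      map_smul' := fun a x ↦ by
        ext1 k
        exact subgroupProjection_mul H a (x k) }
  have hri : r ∘ₗ i = LinearMap.id := by
    refine LinearMap.ext fun x ↦ Finsupp.ext fun k ↦ ?_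
    exact subgroupProjection_subgroupHom H (x k)
  exact (retractOfComp hri).hasInjectiveDimensionLT (n + 1)

end Restriction

/-! ### Exchanging left and right modules by inversion -/

section Antipode

variable {R : Type u} [CommRing R] {G : Type v} [Group G]

/-- The anti-automorphism of the group ring given by inversion in the group. -/
def antipodeHom (R : Type u) [CommRing R] (G : Type v) [Group G] :
    MonoidAlgebra R G →ₐ[R] (MonoidAlgebra R G)ᵐᵒᵖ :=
  MonoidAlgebra.lift R (MonoidAlgebra R G)ᵐᵒᵖ G
    { toFun := fun g ↦ MulOpposite.op (MonoidAlgebra.single g⁻¹ 1)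
      map_one' := by simp [MonoidAlgebra.one_def]
      map_mul' := fun g h ↦ by simp [← MulOpposite.op_mul, MonoidAlgebra.single_mul_single] }

theorem antipodeHom_single (g : G) (r : R) :
    antipodeHom R G (MonoidAlgebra.single g r) =
      MulOpposite.op (MonoidAlgebra.single g⁻¹ r) := by
  simp [antipodeHom, ← MulOpposite.op_smul]

theorem antipodeHom_unop_antipodeHom (x : MonoidAlgebra R G) :
    (antipodeHom R G (antipodeHom R G x).unop).unop = x := by
  induction x using MonoidAlgebra.induction_linear with
  | zero => simp
  | add x y hx hy => simp only [map_add, MulOpposite.unop_add, hx, hy]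
  | single g r => simp [antipodeHom_single]

theorem antipodeHom_bijective : Function.Bijective (antipodeHom R G) := by
  constructor
  · intro x y h
    rw [← antipodeHom_unop_antipodeHom x, h, antipodeHom_unop_antipodeHom]
  · intro x
    refine ⟨(antipodeHom R G x.unop).unop, MulOpposite.unop_injective ?_⟩
    exact antipodeHom_unop_antipodeHom x.unop

/-- The group ring is isomorphic to its opposite. -/
def antipodeEquiv (R : Type u) [CommRing R] (G : Type v) [Group G] :
    MonoidAlgebra R G ≃+* (MonoidAlgebra R G)ᵐᵒᵖ :=
  RingEquiv.ofBijective (antipodeHom R G) antipodeHom_bijective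

attribute [local instance] RingHomInvPair.of_ringEquiv in
theorem hasInjectiveDimensionLE_opposite {n : ℕ}
    (h : HasInjectiveDimensionLE (ModuleCat.of (MonoidAlgebra R G) (ℕ →₀ MonoidAlgebra R G)) n) :
    HasInjectiveDimensionLE
      (ModuleCat.of (MonoidAlgebra R G)ᵐᵒᵖ (ℕ →₀ (MonoidAlgebra R G)ᵐᵒᵖ)) n := by
  let e : (ℕ →₀ MonoidAlgebra R G)
      ≃ₛₗ[RingHomClass.toRingHom (antipodeEquiv R G)] (ℕ →₀ (MonoidAlgebra R G)ᵐᵒᵖ) :=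
    { Finsupp.mapRange.addEquiv (antipodeEquiv R G).toAddEquiv with
      map_smul' := fun a x ↦ by
        ext1 k
        exact map_mul (antipodeEquiv R G) a (x k) }
  exact (ModuleCat.hasInjectiveDimensionLE_iff_of_semiLinearEquiv (antipodeEquiv R G)
    (M := ModuleCat.of _ _) (N := ModuleCat.of _ _) e n).1 h

/-- The opposite of the group ring of a countable group over a noetherian ring is countably
noetherian. -/
theorem countablyNoetherian_monoidAlgebra [IsNoetherianRing R] [Countable G] :
    CountablyNoetherian (MonoidAlgebra R G)ᵐᵒᵖ := by
  obtain ⟨s, hs⟩ := exists_surjective_nat G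
  refine countablyNoetherian_of_countable_span R _
    (fun n ↦ MulOpposite.op (MonoidAlgebra.single (s n) 1)) ?_
  rw [eq_top_iff]
  rintro x -
  obtain ⟨x, rfl⟩ := MulOpposite.op_surjective x
  induction x using MonoidAlgebra.induction_linear with
  | zero => exact zero_mem _
  | add x y hx hy => exact add_mem hx hy
  | single g r =>
    obtain ⟨n, rfl⟩ := hs g
    have := Submodule.smul_mem _ r (Submodule.subset_span (R := R) (Set.mem_range_self
      (f := fun n ↦ (MulOpposite.op (MonoidAlgebra.single (s n) (1 : R)))) n))
    rwa [← MulOpposite.op_smul, MonoidAlgebra.smul_single, smul_eq_mul, mul_one] at this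

end Antipode

/-! ### Reduction of flatness to countable subgroups -/

section Countable

variable {R : Type u} [CommRing R] {G : Type v} [Group G]

/-- The restriction of a right module over the group ring to a subgroup. -/
abbrev restrictRightModule (H : Subgroup G) (A : Type*) [AddCommGroup A]
    [Module (MonoidAlgebra R G)ᵐᵒᵖ A] : Module (MonoidAlgebra R H)ᵐᵒᵖ A :=
  Module.compHom A (RingHom.op (subgroupHom R H).toRingHom)

/-- The relations of the tensor product over the group ring of a subgroup. -/
def subgroupBalancedRel (H : Subgroup G) (A : Type*) [AddCommGroup A]
    [Module (MonoidAlgebra R G)ᵐᵒᵖ A] (M : Type*) [AddCommGroup M] [Module (MonoidAlgebra R G) M] :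
    AddSubgroup (A ⊗[ℤ] M) :=
  letI := restrictModule H (R := R) M
  letI := restrictRightModule H (R := R) A
  balancedRel (MonoidAlgebra R H) A M

variable {A : Type*} [AddCommGroup A] [Module (MonoidAlgebra R G)ᵐᵒᵖ A]
  {M : Type*} [AddCommGroup M] [Module (MonoidAlgebra R G) M]

theorem subgroupBalancedRel_le (H : Subgroup G) :
    subgroupBalancedRel (R := R) H A M ≤ balancedRel (MonoidAlgebra R G) A M := by
  refine (AddSubgroup.closure_le _).2 ?_
  rintro _ ⟨a, r, m, rfl⟩
  exact AddSubgroup.subset_closure ⟨a, subgroupHom R H r, m, rfl⟩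

theorem exists_subgroupHom_eq (H : Subgroup G) (x : MonoidAlgebra R G)
    (hx : ∀ g ∈ x.coeff.support, g ∈ H) : ∃ y, subgroupHom R H y = x := by
  rw [← MonoidAlgebra.sum_coeff_single x]
  refine ⟨∑ g ∈ x.coeff.support.attach, MonoidAlgebra.single ⟨g, hx g g.2⟩ (x.coeff g), ?_⟩
  rw [map_sum, Finsupp.sum]
  exact (Finset.sum_congr rfl fun g _ ↦ subgroupHom_single (R := R) H _ _).trans
    (Finset.sum_attach _ fun g ↦ MonoidAlgebra.single g (x.coeff g))

/-- Each relation of the tensor product over the group ring holds over the group ring of a countable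
subgroup. -/
theorem exists_countable_mem_subgroupBalancedRel {t : A ⊗[ℤ] M}
    (ht : t ∈ balancedRel (MonoidAlgebra R G) A M) :
    ∃ S : Set G, S.Countable ∧ ∀ H : Subgroup G, S ⊆ H → t ∈ subgroupBalancedRel (R := R) H A M := by
  induction ht using AddSubgroup.closure_induction with
  | mem t ht =>
    obtain ⟨a, r, m, rfl⟩ := ht
    refine ⟨r.coeff.support, Finset.countable_toSet _, fun H hH ↦ ?_⟩
    obtain ⟨y, rfl⟩ := exists_subgroupHom_eq H r fun g hg ↦ hH hg
    exact AddSubgroup.subset_closure ⟨a, y, m, rfl⟩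
  | zero => exact ⟨∅, Set.countable_empty, fun H _ ↦ zero_mem _⟩
  | add s t _ _ hs ht =>
    obtain ⟨S, hS, hS'⟩ := hs
    obtain ⟨T, hT, hT'⟩ := ht
    exact ⟨S ∪ T, hS.union hT, fun H hH ↦ add_mem (hS' H (Set.subset_union_left.trans hH))
      (hT' H (Set.subset_union_right.trans hH))⟩
  | neg t _ ht =>
    obtain ⟨T, hT, hT'⟩ := ht
    exact ⟨T, hT, fun H hH ↦ neg_mem (hT' H hH)⟩

/-- A module over the group ring is flat if it is flat over the group rings of all countable
subgroups. -/
theorem isFlat_of_countable_subgroups {M : Type (max u v)} [AddCommGroup M]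
    [Module (MonoidAlgebra R G) M]
    (h : ∀ H : Subgroup G, Countable H →
      letI := restrictModule H (R := R) M
      IsFlat (MonoidAlgebra R H) M) : IsFlat (MonoidAlgebra R G) M := by
  intro A B _ _ _ _ f hf
  rw [injective_iff_map_eq_zero]
  intro t ht
  obtain ⟨t, rfl⟩ := QuotientAddGroup.mk_surjective t
  have ht' : f.toAddMonoidHom.toIntLinearMap.rTensor M t ∈
      balancedRel (MonoidAlgebra R G) B M := (QuotientAddGroup.eq_zero_iff _).1 ht
  -- The vanishing of the image of `t` uses finitely many relations, hence holds over RH for a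
  -- countable subgroup `H`. Flatness over RH makes `t` vanish over RH, and a fortiori over RG.
  obtain ⟨S, hS, hS'⟩ := exists_countable_mem_subgroupBalancedRel ht'
  have hc : Countable (Subgroup.closure S) := by
    have := hS.to_subtype
    have : Countable (FreeGroup S) := Quot.mk_surjective.countable
    rw [← Subtype.range_coe (s := S), ← FreeGroup.range_lift_eq_closure]
    exact (FreeGroup.lift (Subtype.val : S → G)).rangeRestrict_surjective.countable
  have h₁ := hS' (Subgroup.closure S) Subgroup.subset_closure
  have hflat := h _ hc
  let := restrictModule (Subgroup.closure S) (R := R) M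
  let := restrictRightModule (Subgroup.closure S) (R := R) A
  let := restrictRightModule (Subgroup.closure S) (R := R) B
  let f' : A →ₗ[(MonoidAlgebra R (Subgroup.closure S))ᵐᵒᵖ] B :=
    { f with map_smul' := fun a x ↦ f.map_smul _ x }
  have h₂ : BalancedTensor.map (MonoidAlgebra R (Subgroup.closure S)) f' M
      (QuotientAddGroup.mk t) = 0 := (QuotientAddGroup.eq_zero_iff _).2 h₁
  have h₃ := (injective_iff_map_eq_zero _).1 (hflat A B f' hf) _ h₂
  exact (QuotientAddGroup.eq_zero_iff _).2
    (subgroupBalancedRel_le _ ((QuotientAddGroup.eq_zero_iff _).1 h₃))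

/-- A single free cover over RG serves all subgroups at once: it stays projective over RH, so its
character module is injective and passing to its kernel lowers every one of the dimensions by one.
-/
theorem hasFlatDimensionLE_of_countable_subgroups {n : ℕ} {M : Type (max u v)} [AddCommGroup M]
    [Module (MonoidAlgebra R G) M]
    (h : ∀ H : Subgroup G, Countable H →
      letI := restrictModule H (R := R) M
      HasInjectiveDimensionLE (ModuleCat.of (MonoidAlgebra R H)ᵐᵒᵖ (CharacterModule M)) n) :
    HasFlatDimensionLE (ModuleCat.of (MonoidAlgebra R G) M) n := by
  induction n generalizing M with
  | zero =>
    refine hasFlatDimensionLE_zero (isFlat_of_countable_subgroups fun H hH ↦ ?_)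
    let := restrictModule H (R := R) M
    exact isFlat_iff_baer.2 (hasInjectiveDimensionLT_one_iff.1 (h H hH))
  | succ n ih =>
    refine .of_ker (isFlat_finsupp M) (freeCover_surjective M) (ih fun H hH ↦ ?_)
    have h₁ := h H hH
    let := restrictModule H (R := R) M
    let := restrictModule H (R := R) (M →₀ MonoidAlgebra R G)
    let := restrictModule H (R := R) (LinearMap.ker (freeCover (Λ := MonoidAlgebra R G) M))
    let p : (M →₀ MonoidAlgebra R G) →ₗ[MonoidAlgebra R H] M :=
      { freeCover (Λ := MonoidAlgebra R G) M with
        map_smul' := fun a x ↦ (freeCover (Λ := MonoidAlgebra R G) M).map_smul _ x }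
    let i : LinearMap.ker (freeCover (Λ := MonoidAlgebra R G) M) →ₗ[MonoidAlgebra R H]
        (M →₀ MonoidAlgebra R G) :=
      { (LinearMap.ker (freeCover (Λ := MonoidAlgebra R G) M)).subtype with
        map_smul' := fun a x ↦ rfl }
    have hp : Function.Surjective p := freeCover_surjective M
    have hi : Function.Injective i := Submodule.subtype_injective _
    have hip : Function.Exact i p :=
      LinearMap.exact_subtype_ker_map (freeCover (Λ := MonoidAlgebra R G) M)
    have := projective_restrictModule_finsupp (R := R) H M
    have hE : Injective
        (ModuleCat.of (MonoidAlgebra R H)ᵐᵒᵖ (CharacterModule (M →₀ MonoidAlgebra R G))) :=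
      injective_iff_hasInjectiveDimensionLT_one.2
        (hasInjectiveDimensionLT_one_iff.2 (isFlat_iff_baer.1 isFlat_of_projective))
    exact ((shortExact_ofHom (characterMap_injective hp) (characterMap_surjective hi)
      (characterMap_exact hp hip)).hasInjectiveDimensionLT_X₃_iff n hE).2 h₁

/-- If flat modules over the group ring have injective dimension at most `n`, then injective modules
have flat dimension at most `n`. -/
theorem hasFlatDimensionLE_of_injective [IsNoetherianRing R] {n : ℕ}
    (h : ∀ M : ModuleCat.{max u v} (MonoidAlgebra R G), IsFlat (MonoidAlgebra R G) M →
      HasInjectiveDimensionLE M n)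
    (I : ModuleCat.{max u v} (MonoidAlgebra R G)) (hI : Injective I) : HasFlatDimensionLE I n := by
  refine hasFlatDimensionLE_of_countable_subgroups fun H hH ↦ ?_
  have h₁ : Module.Baer (MonoidAlgebra R G) I :=
    hasInjectiveDimensionLT_one_iff.1 (injective_iff_hasInjectiveDimensionLT_one.1 hI)
  let := restrictModule H (R := R) I
  refine hasInjectiveDimensionLE_character countablyNoetherian_monoidAlgebra
    (hasInjectiveDimensionLE_opposite (hasInjectiveDimensionLE_subgroup H (h _ ?_)))
    (baer_restrictModule H h₁)
  exact isFlat_of_projective (M := ℕ →₀ MonoidAlgebra R G)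

end Countable

/-! ### Exactness of diagonal Hom and homological dimensions -/

section DiagonalFunctor

open Representation

namespace DiagonalHom

variable {R : Type*} [CommRing R] {G : Type*} [Group G]
  {M : Type*} [AddCommGroup M] [Module R M] [Module (MonoidAlgebra R G) M]
  [IsScalarTower R (MonoidAlgebra R G) M]
  {M' : Type*} [AddCommGroup M'] [Module R M'] [Module (MonoidAlgebra R G) M']
  [IsScalarTower R (MonoidAlgebra R G) M']
  {M'' : Type*} [AddCommGroup M''] [Module R M''] [Module (MonoidAlgebra R G) M'']
  [IsScalarTower R (MonoidAlgebra R G) M'']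
  {N : Type*} [AddCommGroup N] [Module R N] {σ : Representation R G N}
  {N' : Type*} [AddCommGroup N'] [Module R N'] {σ' : Representation R G N'}
  {N'' : Type*} [AddCommGroup N''] [Module R N''] {σ'' : Representation R G N''}

variable (M) in
/-- Composition with a homomorphism of representations. -/
def mapRight (f : N →ₗ[R] N') (hf : ∀ g n, f (σ g n) = σ' g (f n)) :
    DiagonalHom M σ →ₗ[MonoidAlgebra R G] DiagonalHom M σ' :=
  mkLinear (LinearMap.compRight R f ∘ₗ (toLinearMap σ).toLinearMap) fun g x m ↦ by
    change f (toLinearMap σ (MonoidAlgebra.single g (1 : R) • x) m) = _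
    rw [toLinearMap_single_smul, hf]
    rfl

/-- Composition with a homomorphism of modules over the group ring. -/
def mapLeft (σ : Representation R G N) (f : M →ₗ[MonoidAlgebra R G] M') :
    DiagonalHom M' σ →ₗ[MonoidAlgebra R G] DiagonalHom M σ :=
  mkLinear (LinearMap.lcomp R N (f.restrictScalars R) ∘ₗ (toLinearMap σ).toLinearMap)
    fun g x m ↦ by
      change toLinearMap σ (MonoidAlgebra.single g (1 : R) • x) (f m) = _
      rw [toLinearMap_single_smul, ← map_smul]
      rfl

theorem toLinearMap_mapLeft (f : M →ₗ[MonoidAlgebra R G] M') (x : DiagonalHom M' σ) :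
    toLinearMap σ (mapLeft σ f x) = toLinearMap σ x ∘ₗ f.restrictScalars R := rfl

theorem mapRight_injective {f : N →ₗ[R] N'} (hf : ∀ g n, f (σ g n) = σ' g (f n))
    (h : Function.Injective f) : Function.Injective (mapRight M f hf) := fun _ _ hxy ↦
  (toLinearMap σ).injective <| LinearMap.ext fun m ↦
    h (DFunLike.congr_fun (congrArg (toLinearMap σ') hxy) m)

theorem mapRight_surjective [Module.Projective R M] {f : N →ₗ[R] N'}
    (hf : ∀ g n, f (σ g n) = σ' g (f n)) (h : Function.Surjective f) :
    Function.Surjective (mapRight M f hf) := fun y ↦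
  have ⟨x, hx⟩ := Module.projective_lifting_property f (toLinearMap σ' y) h
  ⟨(toLinearMap σ).symm x, (toLinearMap σ').injective hx⟩

theorem mapRight_exact [Module.Projective R M] {f : N →ₗ[R] N'}
    (hf : ∀ g n, f (σ g n) = σ' g (f n)) {f' : N' →ₗ[R] N''}
    (hf' : ∀ g n, f' (σ' g n) = σ'' g (f' n)) (h : Function.Exact f f') :
    Function.Exact (mapRight M f hf) (mapRight M f' hf') := by
  intro y
  constructor
  · intro hy
    have hy' (m : M) : toLinearMap σ' y m ∈ LinearMap.range f :=
      (h _).1 (DFunLike.congr_fun (congrArg (toLinearMap σ'') hy) m)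
    obtain ⟨x, hx⟩ := Module.projective_lifting_property f.rangeRestrict
      ((toLinearMap σ' y).codRestrict _ hy') f.surjective_rangeRestrict
    refine ⟨(toLinearMap σ).symm x, (toLinearMap σ').injective (LinearMap.ext fun m ↦ ?_)⟩
    exact congrArg Subtype.val (DFunLike.congr_fun hx m)
  · rintro ⟨x, rfl⟩
    exact (toLinearMap σ'').injective (LinearMap.ext fun m ↦ h.apply_apply_eq_zero _)

theorem mapLeft_injective {f : M →ₗ[MonoidAlgebra R G] M'} (h : Function.Surjective f) :
    Function.Injective (mapLeft σ f) := fun _ _ hxy ↦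
  (toLinearMap σ).injective <| LinearMap.ext <| h.forall.2 fun m ↦
    DFunLike.congr_fun (congrArg (toLinearMap σ) hxy) m

theorem mapLeft_surjective (hN : Module.Baer R N) {f : M →ₗ[MonoidAlgebra R G] M'}
    (h : Function.Injective f) : Function.Surjective (mapLeft σ f) := fun y ↦
  have ⟨x, hx⟩ := hN.extension_property (f.restrictScalars R) h (toLinearMap σ y)
  ⟨(toLinearMap σ).symm x, (toLinearMap σ).injective hx⟩

theorem mapLeft_exact {f : M →ₗ[MonoidAlgebra R G] M'} {f' : M' →ₗ[MonoidAlgebra R G] M''}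
    (h : Function.Exact f f') (hf' : Function.Surjective f') :
    Function.Exact (mapLeft σ f') (mapLeft σ f) := by
  intro y
  constructor
  · intro hy
    obtain ⟨x, hx⟩ := exists_linearMap_comp_eq (p := f'.restrictScalars R) hf'
      (f := toLinearMap σ y) fun m hm ↦ by
        obtain ⟨n, rfl⟩ := (h m).1 hm
        exact DFunLike.congr_fun (congrArg (toLinearMap σ) hy) n
    exact ⟨(toLinearMap σ).symm x, (toLinearMap σ).injective hx⟩
  · rintro ⟨x, rfl⟩
    refine (toLinearMap σ).injective (LinearMap.ext fun m ↦ ?_)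
    simp [toLinearMap_mapLeft, h.apply_apply_eq_zero]

end DiagonalHom

variable {R : Type u} [CommRing R] {G : Type v} [Group G]

/-- If the projective dimensions of injective modules over the group ring are bounded, then coinduced
modules from `R`-modules of finite injective dimension satisfy the same bound. -/
theorem hasProjectiveDimensionLE_diagonalHom {s : ℕ}
    (h : ∀ E : ModuleCat.{max u v} (MonoidAlgebra R G), Injective E →
      HasProjectiveDimensionLE E s) {d : ℕ} (X : Type u) [AddCommGroup X] [Module R X]
    (hX : HasInjectiveDimensionLE (ModuleCat.of R X) d) :
    HasProjectiveDimensionLE (ModuleCat.of (MonoidAlgebra R G)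
      (DiagonalHom (MonoidAlgebra R G) (Representation.trivial R G X))) s := by
  have key (X : Type u) [AddCommGroup X] [Module R X]
      (hX : HasInjectiveDimensionLE (ModuleCat.of R X) 0) :
      HasProjectiveDimensionLE (ModuleCat.of (MonoidAlgebra R G)
        (DiagonalHom (MonoidAlgebra R G) (Representation.trivial R G X))) s :=
    h _ (injective_iff_hasInjectiveDimensionLT_one.2 (hasInjectiveDimensionLT_one_iff.2
      (DiagonalHom.baer (hasInjectiveDimensionLT_one_iff.1 hX))))
  induction d generalizing X with
  | zero => exact key X hX
  | succ d ih =>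
    obtain ⟨E, f, hE, hf⟩ := exists_injective_embedding (Λ := R) X
    have hC := ih _ (((shortExact_coker hf).hasInjectiveDimensionLT_X₃_iff d hE).2 hX)
    have hE' := key E (injective_iff_hasInjectiveDimensionLT_one.1 hE)
    let σ' := Representation.trivial R G E
    let σ'' := Representation.trivial R G (E ⧸ LinearMap.range f)
    have hS := shortExact_ofHom
      (DiagonalHom.mapRight_injective (M := MonoidAlgebra R G) (σ' := σ') (fun g n ↦ rfl) hf)
      (DiagonalHom.mapRight_surjective (M := MonoidAlgebra R G) (σ := σ') (σ' := σ'')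
        (fun g n ↦ rfl) (Submodule.mkQ_surjective (LinearMap.range f)))
      (DiagonalHom.mapRight_exact (σ := Representation.trivial R G X) (fun g n ↦ rfl)
        (fun g n ↦ rfl) (LinearMap.exact_map_mkQ_range f))
    -- The module in question is the kernel, so the bound `s` does not grow with `d`.
    exact hS.hasProjectiveDimensionLT_X₁ (s + 1) hE'
      (hasProjectiveDimensionLT_of_ge _ (s + 1) (s + 1 + 1) (Nat.le_succ _))

/-- Since `N` is injective over `R`, the contravariant functor `Hom_R(-, N)` is exact, and it sends
free modules to injective ones; projective resolutions thus become injective resolutions. -/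
theorem hasInjectiveDimensionLE_diagonalHom {s : ℕ} {N : Type (max u v)} [AddCommGroup N]
    [Module R N] (hN : Module.Baer R N) (σ : Representation R G N) (C : Type (max u v))
    [AddCommGroup C] [Module (MonoidAlgebra R G) C] [Module R C]
    [IsScalarTower R (MonoidAlgebra R G) C]
    (hC : HasProjectiveDimensionLE (ModuleCat.of (MonoidAlgebra R G) C) s) :
    HasInjectiveDimensionLE (ModuleCat.of (MonoidAlgebra R G) (DiagonalHom C σ)) s := by
  induction s generalizing C with
  | zero =>
    have : Projective (ModuleCat.of (MonoidAlgebra R G) C) :=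
      (projective_iff_hasProjectiveDimensionLE_zero _).2 hC
    have : Module.Projective (MonoidAlgebra R G) C :=
      ModuleCat.projective_of_module_projective (ModuleCat.of (MonoidAlgebra R G) C)
    obtain ⟨i, hi⟩ := Module.projective_lifting_property
      (freeCover (Λ := MonoidAlgebra R G) C) LinearMap.id (freeCover_surjective C)
    refine hasInjectiveDimensionLT_one_iff.2 (baer_of_retract
      (i := DiagonalHom.mapLeft σ (freeCover (Λ := MonoidAlgebra R G) C))
      (r := DiagonalHom.mapLeft σ i) ?_ (DiagonalHom.baer hN))
    refine LinearMap.ext fun x ↦ (DiagonalHom.toLinearMap σ).injective (LinearMap.ext fun m ↦ ?_)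
    exact congrArg (DiagonalHom.toLinearMap σ x) (DFunLike.congr_fun hi m)
  | succ s ih =>
    have hK := ih (LinearMap.ker (freeCover (Λ := MonoidAlgebra R G) C))
      (((shortExact_ker (freeCover_surjective (Λ := MonoidAlgebra R G)
        C)).hasProjectiveDimensionLT_X₃_iff s (projective_free C)).1 hC)
    have hS := shortExact_ofHom
      (DiagonalHom.mapLeft_injective (σ := σ) (freeCover_surjective (Λ := MonoidAlgebra R G) C))
      (DiagonalHom.mapLeft_surjective hN (Submodule.subtype_injective
        (LinearMap.ker (freeCover (Λ := MonoidAlgebra R G) C))))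
      (DiagonalHom.mapLeft_exact (LinearMap.exact_subtype_ker_map _) (freeCover_surjective C))
    exact (hS.hasInjectiveDimensionLT_X₃_iff s (injective_iff_hasInjectiveDimensionLT_one.2
      (hasInjectiveDimensionLT_one_iff.2 (DiagonalHom.baer hN)))).1 hK

end DiagonalFunctor

/-! ### Induced modules and injective dimension of free modules -/

section Induced

open Representation

/-- Direct sums of copies of an injective module over a noetherian ring are injective. -/
theorem baer_finsupp {R E ι : Type*} [Ring R] [IsNoetherianRing R] [AddCommGroup E] [Module R E]
    (hE : Module.Baer R E) : Module.Baer R (ι →₀ E) := by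
  classical
  intro J g
  obtain ⟨S, hS⟩ := IsNoetherian.noetherian (⊤ : Submodule R J)
  let T : Finset ι := S.biUnion fun x ↦ (g x).support
  have hT (x : J) (i : ι) (hi : i ∉ T) : g x i = 0 := by
    have hx : x ∈ Submodule.span R (S : Set J) := hS ▸ Submodule.mem_top
    induction hx using Submodule.span_induction with
    | mem x hx =>
      by_contra hne
      exact hi (Finset.mem_biUnion.2 ⟨x, hx, Finsupp.mem_support_iff.2 hne⟩)
    | zero => simp
    | add x y _ _ hx hy => simp [hx, hy]
    | smul a x _ hx => simp [hx]
  choose k hk using fun i ↦ hE J (Finsupp.lapply i ∘ₗ g)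
  refine ⟨∑ i ∈ T, Finsupp.lsingle i ∘ₗ k i, fun x hx ↦ Finsupp.ext fun i ↦ ?_⟩
  have : (∑ j ∈ T, Finsupp.lsingle j ∘ₗ k j) x i = ∑ j ∈ T, Finsupp.single j (k j x) i := by
    simp [LinearMap.sum_apply, Finsupp.finsetSum_apply]
  rw [this]
  by_cases hi : i ∈ T
  · rw [Finset.sum_eq_single_of_mem i hi fun j _ hj ↦ Finsupp.single_eq_of_ne hj.symm,
      Finsupp.single_eq_same, hk i x hx]
    rfl
  · rw [Finset.sum_eq_zero fun j hj ↦ Finsupp.single_eq_of_ne (by rintro rfl; exact hi hj),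
      hT _ i hi]

variable {R : Type u} [CommRing R] {G : Type v} [Group G] {F : Type (max u v)} [AddCommGroup F]
  [Module (MonoidAlgebra R G) F] [Module R F] [IsScalarTower R (MonoidAlgebra R G) F]

theorem baer_tensor [IsNoetherianRing R] [Module.Free R F] {E : Type u} [AddCommGroup E]
    [Module R E] (hE : Module.Baer R E) : Module.Baer R (F ⊗[R] E) :=
  (baer_finsupp hE).of_equiv
    (TensorProduct.equivFinsuppOfBasisLeft (Module.Free.chooseBasis R F)).symm

variable (R G) in
/-- The coinduced module of the trivial module `R`. -/
abbrev Coinduced : Type (max u v) :=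
  DiagonalHom (MonoidAlgebra R G) (Representation.trivial R G R)

variable (R G) in
/-- The augmentation as an element of the coinduced module. -/
def coinducedAugmentation : Coinduced R G :=
  (DiagonalHom.toLinearMap _).symm (augmentation R G).toLinearMap

theorem single_smul_coinducedAugmentation (g : G) :
    MonoidAlgebra.single g (1 : R) • coinducedAugmentation R G = coinducedAugmentation R G := by
  refine (DiagonalHom.toLinearMap _).injective (LinearMap.ext fun x ↦ ?_)
  rw [DiagonalHom.toLinearMap_single_smul]
  simp [coinducedAugmentation, augmentation_single]

variable (R G) in
/-- Evaluation at the unit. -/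
def coinducedEval : Coinduced R G →ₗ[R] R :=
  LinearMap.applyₗ 1 ∘ₗ (DiagonalHom.toLinearMap _).toLinearMap

theorem coinducedEval_augmentation : coinducedEval R G (coinducedAugmentation R G) = 1 := by
  simp [coinducedEval, coinducedAugmentation]

/-- Evaluation at the augmentation. -/
def evalAugmentation (N : Type*) [AddCommGroup N] [Module R N] [Module (MonoidAlgebra R G) N]
    [IsScalarTower R (MonoidAlgebra R G) N] :
    DiagonalHom (Coinduced R G) (ofModule' (k := R) (G := G) N) →ₗ[MonoidAlgebra R G] N :=
  MonoidAlgebra.equivariantOfLinearOfComm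
    (LinearMap.applyₗ (coinducedAugmentation R G) ∘ₗ (DiagonalHom.toLinearMap _).toLinearMap)
    fun g f ↦ by
      change DiagonalHom.toLinearMap _ (MonoidAlgebra.single g (1 : R) • f)
        (coinducedAugmentation R G) = _
      rw [DiagonalHom.toLinearMap_single_smul, single_smul_coinducedAugmentation]
      rfl

/-- An induced module is a retract of its coinduction. -/
theorem exists_section_evalAugmentation [Module.Free (MonoidAlgebra R G) F] (E : Type u)
    [AddCommGroup E] [Module R E] :
    ∃ j : F ⊗[R] E →ₗ[MonoidAlgebra R G]
        DiagonalHom (Coinduced R G) (ofModule' (k := R) (G := G) (F ⊗[R] E)),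
      evalAugmentation (F ⊗[R] E) ∘ₗ j = LinearMap.id := by
  let b := Module.Free.chooseBasis (MonoidAlgebra R G) F
  let σ := ofModule' (k := R) (G := G) (F ⊗[R] E)
  -- A pure tensor `b k ⊗ e` goes to the map `y ↦ y(1) • (b k ⊗ e)`, whose value at the augmentation
  -- is `b k ⊗ e` again. Evaluation at 1 is not equivariant, so this is prescribed on the basis and
  -- extended.
  let c (k) : E →ₗ[R] DiagonalHom (Coinduced R G) σ :=
    (DiagonalHom.toLinearMap σ).symm.toLinearMap ∘ₗ
      (LinearMap.smulRightₗ (coinducedEval R G)) ∘ₗ TensorProduct.mk R F E (b k)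
  let l : F →ₗ[MonoidAlgebra R G] E →ₗ[R] DiagonalHom (Coinduced R G) σ := b.constr ℕ c
  refine ⟨TensorProduct.AlgebraTensorModule.lift l, ?_⟩
  refine TensorProduct.AlgebraTensorModule.curry_injective (b.ext fun k ↦ LinearMap.ext fun e ↦ ?_)
  have hl : l (b k) = c k := b.constr_basis ℕ c k
  change evalAugmentation (F ⊗[R] E) (l (b k) e) = b k ⊗ₜ[R] e
  rw [hl]
  change coinducedEval R G (coinducedAugmentation R G) • (b k ⊗ₜ[R] e) = b k ⊗ₜ[R] e
  rw [coinducedEval_augmentation, one_smul]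

/-- For `X` injective, `F ⊗ X` is injective over the noetherian ring `R` and is a retract of its
diagonal Hom from the coinduced module, which gives `s`. Each step of an injective resolution of `X`
then adds one. -/
theorem hasInjectiveDimensionLE_tensor [IsNoetherianRing R] [Module.Free (MonoidAlgebra R G) F]
    {s : ℕ} (h : HasProjectiveDimensionLE (ModuleCat.of (MonoidAlgebra R G) (Coinduced R G)) s)
    {d : ℕ} {X : Type u} [AddCommGroup X] [Module R X]
    (hX : HasInjectiveDimensionLE (ModuleCat.of R X) d) :
    HasInjectiveDimensionLE (ModuleCat.of (MonoidAlgebra R G) (F ⊗[R] X)) (d + s) := by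
  have : Module.Free R F := Module.Free.trans (S := MonoidAlgebra R G)
  have key (E : Type u) [AddCommGroup E] [Module R E]
      (hE : HasInjectiveDimensionLE (ModuleCat.of R E) 0) :
      HasInjectiveDimensionLE (ModuleCat.of (MonoidAlgebra R G) (F ⊗[R] E)) s := by
    obtain ⟨j, hj⟩ := exists_section_evalAugmentation (R := R) (G := G) (F := F) E
    have := hasInjectiveDimensionLE_diagonalHom
      (baer_tensor (F := F) (hasInjectiveDimensionLT_one_iff.1 hE))
      (ofModule' (k := R) (G := G) (F ⊗[R] E)) _ h
    exact (retractOfComp (i := j) (r := evalAugmentation (F ⊗[R] E)) hj).hasInjectiveDimensionLT (s + 1)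
  induction d generalizing X with
  | zero => simpa using key X hX
  | succ d ih =>
    obtain ⟨E, f, hE, hf⟩ := exists_injective_embedding (Λ := R) X
    have hC := ih (((shortExact_coker hf).hasInjectiveDimensionLT_X₃_iff d hE).2 hX)
    have hE' := key E (injective_iff_hasInjectiveDimensionLT_one.1 hE)
    have hS := shortExact_ofHom
      (f := TensorProduct.AlgebraTensorModule.lTensor (MonoidAlgebra R G) F f)
      (g := TensorProduct.AlgebraTensorModule.lTensor (MonoidAlgebra R G) F
        (LinearMap.range f).mkQ)
      (Module.Flat.lTensor_preserves_injective_linearMap (M := F) f hf)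
      (LinearMap.lTensor_surjective F (Submodule.mkQ_surjective _))
      (lTensor_exact F (LinearMap.exact_map_mkQ_range f) (Submodule.mkQ_surjective _))
    have := hS.hasInjectiveDimensionLT_X₁ (d + s + 1) hC
      (hasInjectiveDimensionLT_of_ge _ (s + 1) (d + s + 1 + 1) (by lia))
    rwa [show d + s + 1 = d + 1 + s by ring] at this

/-- Injective dimensions of modules of finite projective dimension are bounded by those of free
modules. -/
theorem hasInjectiveDimensionLE_of_hasProjectiveDimensionLE {Λ : Type u} [Ring Λ] {t : ℕ}
    (h : ∀ ι : Type u, HasInjectiveDimensionLE (ModuleCat.of Λ (ι →₀ Λ)) t) {k : ℕ}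
    {M : ModuleCat.{u} Λ} (hM : HasProjectiveDimensionLE M k) : HasInjectiveDimensionLE M t := by
  induction k generalizing M with
  | zero =>
    have : Projective M := (projective_iff_hasProjectiveDimensionLE_zero M).2 hM
    have : Module.Projective Λ M := ModuleCat.projective_of_module_projective M
    obtain ⟨i, hi⟩ := Module.projective_lifting_property
      (freeCover (Λ := Λ) M) LinearMap.id (freeCover_surjective M)
    have := h M
    exact (retractOfComp hi).hasInjectiveDimensionLT (t + 1)
  | succ k ih =>
    have hS := shortExact_ker (freeCover_surjective (Λ := Λ) M)
    have hK := ih ((hS.hasProjectiveDimensionLT_X₃_iff k (projective_free M)).1 hM)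
    -- A quotient of modules of injective dimension at most `t` satisfies the same bound, whatever
    -- the length `k` of the resolution.
    exact hS.hasInjectiveDimensionLT_X₃ (t + 1) (h M)
      (hasInjectiveDimensionLT_of_ge _ (t + 1) (t + 1 + 1) (Nat.le_succ _))

/-- Over a noetherian ring `R` of finite self-injective dimension, modules of finite projective
dimension over the group ring have bounded injective dimension, if the projective dimensions of
injective modules are bounded. -/
theorem hasInjectiveDimensionLE_of_gorenstein [IsNoetherianRing R] {s d k : ℕ}
    (hR : HasInjectiveDimensionLE (ModuleCat.of R R) d)
    (h : ∀ E : ModuleCat.{max u v} (MonoidAlgebra R G), Injective E →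
      HasProjectiveDimensionLE E s)
    {M : ModuleCat.{max u v} (MonoidAlgebra R G)} (hM : HasProjectiveDimensionLE M k) :
    HasInjectiveDimensionLE M (d + s) := by
  refine hasInjectiveDimensionLE_of_hasProjectiveDimensionLE (fun ι ↦ ?_) hM
  have h₁ := hasInjectiveDimensionLE_tensor (F := ι →₀ MonoidAlgebra R G)
    (hasProjectiveDimensionLE_diagonalHom h R hR) hR
  let e : (ι →₀ MonoidAlgebra R G) ⊗[R] R ≃ₗ[MonoidAlgebra R G] (ι →₀ MonoidAlgebra R G) :=
    TensorProduct.AlgebraTensorModule.rid R (MonoidAlgebra R G) (ι →₀ MonoidAlgebra R G)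
  let φ : ModuleCat.of (MonoidAlgebra R G) ((ι →₀ MonoidAlgebra R G) ⊗[R] R) ≅
    ModuleCat.of (MonoidAlgebra R G) (ι →₀ MonoidAlgebra R G) := LinearEquiv.toModuleIso e
  exact hasInjectiveDimensionLT_of_iso φ _

end Induced

/-! ### Finiteness of the invariants and the equivalences -/

section Finiteness

variable {Λ : Type u} [Ring Λ]

theorem flatDimension_le_of_hasFlatDimensionLE {M : ModuleCat.{u} Λ} {n : ℕ}
    (h : HasFlatDimensionLE M n) : flatDimension M ≤ n := iInf₂_le n h

theorem flatDimension_lt_top_iff {M : ModuleCat.{u} Λ} :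
    flatDimension M < ⊤ ↔ ∃ n, HasFlatDimensionLE M n := by
  refine ⟨fun h ↦ ?_, fun ⟨n, hn⟩ ↦
    (flatDimension_le_of_hasFlatDimensionLE hn).trans_lt (ENat.natCast_lt_top n)⟩
  by_contra! hn
  exact h.ne (iInf₂_eq_top.2 fun n h ↦ (hn n h).elim)

theorem exists_natCast_ge {x : WithBot ℕ∞} (h : x < ⊤) : ∃ n : ℕ, x ≤ n := by
  induction x with
  | bot => exact ⟨0, bot_le⟩
  | coe x =>
    induction x with
    | top => exact absurd h (lt_irrefl _)
    | coe n => exact ⟨n, le_rfl⟩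

theorem natCast_lt_top (n : ℕ) : (n : WithBot ℕ∞) < ⊤ :=
  WithBot.coe_lt_coe.2 (ENat.natCast_lt_top n)

theorem silf_lt_top_iff : silf Λ < ⊤ ↔
    ∃ n, ∀ M : ModuleCat.{u} Λ, IsFlat Λ M → HasInjectiveDimensionLE M n := by
  constructor
  · intro h
    obtain ⟨n, hn⟩ := exists_natCast_ge h
    exact ⟨n, fun M hM ↦ (injectiveDimension_le_iff M n).1 ((le_iSup₂_of_le M hM le_rfl).trans hn)⟩
  · rintro ⟨n, hn⟩
    exact (iSup₂_le fun M hM ↦ (injectiveDimension_le_iff M n).2 (hn M hM)).trans_lt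
      (natCast_lt_top n)

theorem splf_lt_top_iff : splf Λ < ⊤ ↔
    ∃ n, ∀ M : ModuleCat.{u} Λ, IsFlat Λ M → HasProjectiveDimensionLE M n := by
  constructor
  · intro h
    obtain ⟨n, hn⟩ := exists_natCast_ge h
    exact ⟨n, fun M hM ↦
      (projectiveDimension_le_iff M n).1 ((le_iSup₂_of_le M hM le_rfl).trans hn)⟩
  · rintro ⟨n, hn⟩
    exact (iSup₂_le fun M hM ↦ (projectiveDimension_le_iff M n).2 (hn M hM)).trans_lt
      (natCast_lt_top n)

theorem HasFlatDimensionLE.mono {M : ModuleCat.{u} Λ} {m n : ℕ} (h : HasFlatDimensionLE M m)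
    (hmn : m ≤ n) : HasFlatDimensionLE M n := by
  obtain ⟨F, d, ε, hF, hF', hε⟩ := h
  exact ⟨F, d, ε, hF, fun i hi ↦ hF' i (hmn.trans_lt hi), hε⟩

theorem hasFlatDimensionLE_of_flatDimension_le {M : ModuleCat.{u} Λ} {n : ℕ}
    (h : flatDimension M ≤ n) : HasFlatDimensionLE M n := by
  by_contra hn
  have : ((n + 1 : ℕ) : ℕ∞) ≤ flatDimension M := le_iInf₂ fun m hm ↦
    Nat.cast_le.2 (not_le.1 fun hmn ↦ hn (hm.mono hmn))
  exact absurd (Nat.cast_le.1 (this.trans h)) (Nat.not_succ_le_self n)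

theorem sfli_lt_top_iff : sfli Λ < ⊤ ↔
    ∃ n, ∀ M : ModuleCat.{u} Λ, Injective M → HasFlatDimensionLE M n := by
  constructor
  · intro h
    obtain ⟨n, hn⟩ := ENat.ne_top_iff_exists.1 h.ne
    exact ⟨n, fun M hM ↦ hasFlatDimensionLE_of_flatDimension_le
      ((le_iSup₂_of_le M hM le_rfl).trans hn.ge)⟩
  · rintro ⟨n, hn⟩
    exact (iSup₂_le fun M hM ↦ flatDimension_le_of_hasFlatDimensionLE (hn M hM)).trans_lt
      (ENat.natCast_lt_top n)

/-- Flat modules of unbounded projective dimension have a flat direct sum of which each is a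
retract, so that sum would have infinite projective dimension. Conversely, a bound for flat modules
turns a finite flat resolution into a bound on the projective dimension. -/
theorem finiteProjectiveDimension_eq_finiteFlatDimension_iff :
    finiteProjectiveDimension Λ = finiteFlatDimension Λ ↔ splf Λ < ⊤ := by
  classical
  have hpd (M : ModuleCat.{u} Λ) : projectiveDimension M < ⊤ ↔
      ∃ n, HasProjectiveDimensionLE M n := by
    rw [lt_top_iff_ne_top, projectiveDimension_ne_top_iff]
  constructor
  · intro h
    rw [splf_lt_top_iff]
    by_contra! hn
    choose M hM hM' using hn
    let N (i : ULift.{u} ℕ) : Type u := M i.down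
    have hN : IsFlat Λ (DirectSum (ULift.{u} ℕ) N) := isFlat_directSum fun i ↦ hM i.down
    have hfd : ModuleCat.of Λ (DirectSum (ULift.{u} ℕ) N) ∈ finiteFlatDimension Λ :=
      flatDimension_lt_top_iff.2 ⟨0, hasFlatDimensionLE_zero hN⟩
    rw [← h] at hfd
    obtain ⟨n, hn⟩ := (hpd _).1 hfd
    have hr : DirectSum.component Λ (ULift.{u} ℕ) N ⟨n⟩ ∘ₗ DirectSum.lof Λ (ULift.{u} ℕ) N ⟨n⟩ =
        LinearMap.id := LinearMap.ext fun x ↦ DirectSum.component.lof_self Λ _ _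
    exact hM' n ((retractOfComp hr).hasProjectiveDimensionLT (n + 1))
  · intro h
    obtain ⟨k, hk⟩ := splf_lt_top_iff.1 h
    ext M
    refine (hpd M).trans (Iff.trans ⟨?_, ?_⟩ flatDimension_lt_top_iff.symm)
    · exact fun ⟨n, hn⟩ ↦ ⟨n, hasFlatDimensionLE_of_hasProjectiveDimensionLE hn⟩
    · exact fun ⟨n, hn⟩ ↦ ⟨n + k, hn.hasProjectiveDimensionLE hk⟩

/-- Finiteness of the injective dimensions of flat modules over the group ring of a Gorenstein ring,
in terms of the flat dimensions of injective modules and the projective dimensions of flat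
modules. -/
theorem silf_lt_top_iff_sfli_splf (R : Type u) [CommRing R] [IsGorensteinRing R] (G : Type v)
    [Group G] : silf (MonoidAlgebra R G) < ⊤ ↔
      sfli (MonoidAlgebra R G) < ⊤ ∧ splf (MonoidAlgebra R G) < ⊤ := by
  have := IsGorensteinRing.isNoetherianRing (R := R)
  constructor
  · intro h
    obtain ⟨n, hn⟩ := silf_lt_top_iff.1 h
    exact ⟨sfli_lt_top_iff.2 ⟨n, fun I hI ↦ hasFlatDimensionLE_of_injective hn I hI⟩,
      splf_lt_top_iff.2 ⟨n, fun M hM ↦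
        hasProjectiveDimensionLE_of_hasInjectiveDimensionLE_flat hn M hM⟩⟩
  · rintro ⟨h₁, h₂⟩
    obtain ⟨m, hm⟩ := sfli_lt_top_iff.1 h₁
    obtain ⟨k, hk⟩ := splf_lt_top_iff.1 h₂
    obtain ⟨d, hd⟩ := (injectiveDimension_ne_top_iff _).1
      (IsGorensteinRing.injectiveDimension_lt_top (R := R)).ne
    -- Here `m + k` bounds the projective dimension of injective modules: flat dimension at most
    -- `m`, with flat modules of projective dimension at most `k`.
    exact silf_lt_top_iff.2 ⟨d + (m + k), fun M hM ↦ hasInjectiveDimensionLE_of_gorenstein hd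
      (fun E hE ↦ (hm E hE).hasProjectiveDimensionLE hk) (hk M hM)⟩

end Finiteness
end GroupRingDim

end

theorem proposition5p2 (R : Type u) [CommRing R] [GroupRingDim.IsGorensteinRing R]
    (G : Type v) [Group G] :
    List.TFAE [
      GroupRingDim.silf (MonoidAlgebra R G) < ⊤,
      GroupRingDim.sfli (MonoidAlgebra R G) < ⊤ ∧ GroupRingDim.splf (MonoidAlgebra R G) < ⊤,
      GroupRingDim.sfli (MonoidAlgebra R G) < ⊤ ∧
        GroupRingDim.finiteProjectiveDimension (MonoidAlgebra R G) =
          GroupRingDim.finiteFlatDimension (MonoidAlgebra R G)] := by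
  rw [GroupRingDim.finiteProjectiveDimension_eq_finiteFlatDimension_iff]
  tfae_have 1 ↔ 2 := GroupRingDim.silf_lt_top_iff_sfli_splf R G
  tfae_have 2 ↔ 3 := Iff.rfl
  tfae_finish
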